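/- Let $a,b,c\in\mathbb Z_{\ge 2}\cup\{\infty\}$ satisfy $\frac1a+\frac1b+\frac1c<1$ (with $\frac1\infty=0$). Let $T$ be a triangle in the hyperbolic plane with angles $\pi/a,\pi/b,\pi/c$, let $\Delta\le\mathrm{PSL}_2(\mathbb R)$ be the group of orientation-preserving elements of the group generated by the reflections in the sides of $T$, and let $\Delta^{(2)}\le\mathrm{SL}_2(\mathbb R)$ be the subgroup generated by $-1$ and the squares $\delta^2$, where $\delta$ runs over the elements of the preimage of $\Delta$ in $\mathrm{SL}_2(\mathbb R)$. Let $E=\mathbb Q(\operatorname{Tr}\Delta^{(2)})\subset\mathbb R$ be the invariant trace field, and let $A\subseteq\mathrm M_2(\mathbb R)$ be the $E$-subalgebra generated by $\Delta^{(2)}$. The arithmetic dimension $\operatorname{adim}(a,b,c)$ is the number of split real places of $A$, that is, the number of real places $v$ of $E$ such that $A\otimes_{E,v}\mathbb R\simeq \mathrm M_2(\mathbb R)$. For $s\in\mathbb Z_{\ge2}\cup\{\infty\}$ let $\zeta_s=\exp(2\pi i/s)$ and $\lambda_s=2\cos(2\pi/s)$, so that $\zeta_\infty=1$ and $\lambda_\infty=2$.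 Let $m=\operatorname{lcm}(\{a,b,c\}\smallsetminus\{\infty\})$ (so $m=1$ if $a=b=c=\infty$) and $K=\mathbb Q(\zeta_{2a},\zeta_{2b},\zeta_{2c})$. For $k\in(\mathbb Z/2m\mathbb Z)^\times$ let $\sigma_k\in\operatorname{Gal}(K/\mathbb Q)$ be the automorphism with $\sigma_k(\zeta_{2m})=\zeta_{2m}^k$; identify $(\mathbb Z/2m\mathbb Z)^\times$ with $\operatorname{Gal}(K/\mathbb Q)$ by $k\mapsto\sigma_k$, and let $H\le(\mathbb Z/2m\mathbb Z)^\times$ be the subgroup corresponding to $\operatorname{Gal}(K/E)$. Put $$\beta=\lambda_a+\lambda_b+\lambda_c+\lambda_{2a}\lambda_{2b}\lambda_{2c}+2,$$ $$\kappa(a,b,c;k)=1-\Bigl(\cos^2\tfrac{k\pi}{a}+\cos^2\tfrac{k\pi}{b}+\cos^2\tfrac{k\pi}{c}+2\cos\tfrac{k\pi}{a}\cos\tfrac{k\pi}{b}\cos\tfrac{k\pi}{c}\Bigr).$$ Then $\sigma_k(\beta)$ and $\kappa(a,b,c;k)$ depend only on the class of $k$ in $(\mathbb Z/2m\mathbb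 Z)^\times/H$, and $$\operatorname{adim}(a,b,c)=\#\{k\in(\mathbb Z/2m\mathbb Z)^\times/H:\sigma_k(\beta)>0\}=\#\{k\in(\mathbb Z/2m\mathbb Z)^\times/H:\kappa(a,b,c;k)<0\},$$ where, moreover, the two sets of classes are equal. -/

import Mathlib

open scoped TensorProduct MatrixGroups ComplexOrder

noncomputable section

namespace TriangleGroup

/-! ### Triples of extended integers -/

/-- The real number `1 / s` for `s ∈ ℕ ∪ {∞}`, where `1 / ∞ = 0`. -/
def recip : ℕ∞ → ℝ
  | ⊤ => 0
  | (n : ℕ) => 1 / (n : ℝ)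

/-- `s` itself if `s` is finite, and `1` (the neutral element for `lcm`) if `s = ∞`. -/
def finPart : ℕ∞ → ℕ
  | ⊤ => 1
  | (n : ℕ) => n

/-- A hyperbolic triple: `a, b, c ∈ ℤ_{≥ 2} ∪ {∞}` with `1/a + 1/b + 1/c - 1 < 0`. -/
structure HyperbolicTriple where
  a : ℕ∞
  b : ℕ∞
  c : ℕ∞
  two_le_a : 2 ≤ a
  two_le_b : 2 ≤ b
  two_le_c : 2 ≤ c
  chi_neg : recip a + recip b + recip c - 1 < 0

/-- `ζ_s = exp (2πi / s)`, so that `ζ_∞ = 1`. -/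
def zeta (s : ℕ∞) : ℂ := Complex.exp (2 * Real.pi * Complex.I * (recip s : ℂ))

/-- `λ_s = 2 cos (2π / s)`, so that `λ_∞ = 2`. -/
def lam (s : ℕ∞) : ℝ := 2 * Real.cos (2 * Real.pi * recip s)

lemma finPart_pos {s : ℕ∞} (hs : 2 ≤ s) : 0 < finPart s := by
  cases s with
  | top => exact Nat.one_pos
  | coe n =>
    have : 2 ≤ n := by exact_mod_cast hs
    show 0 < n
    omega

lemma zeta_coe (n : ℕ) : zeta (n : ℕ∞) = Complex.exp (2 * Real.pi * Complex.I / n) := by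
  show Complex.exp (2 * Real.pi * Complex.I * ((1 / (n : ℝ) : ℝ) : ℂ)) = _
  congr 1
  push_cast
  ring

lemma zeta_top : zeta ⊤ = 1 := by
  show Complex.exp (2 * Real.pi * Complex.I * ((0 : ℝ) : ℂ)) = _
  simp

lemma recip_two_mul (s : ℕ∞) : 2 * recip (2 * s) = recip s := by
  cases s with
  | top =>
    have h : (2 : ℕ∞) * ⊤ = ⊤ := by simp
    rw [h]
    show 2 * (0 : ℝ) = 0
    simp
  | coe n =>
    have h : (2 : ℕ∞) * (n : ℕ∞) = ((2 * n : ℕ) : ℕ∞) := by push_cast; rfl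
    rw [h]
    show 2 * (1 / ((2 * n : ℕ) : ℝ)) = 1 / (n : ℝ)
    push_cast
    rcases eq_or_ne (n : ℝ) 0 with h0 | h0
    · simp [h0]
    · field_simp

lemma zeta_two_mul_sq (s : ℕ∞) : zeta (2 * s) ^ 2 = zeta s := by
  rw [zeta, zeta, ← Complex.exp_nat_mul, ← recip_two_mul s]
  congr 1
  push_cast
  ring

lemma lam_eq (s : ℕ∞) : (lam s : ℂ) = zeta s + (zeta s)⁻¹ := by
  rw [lam, zeta, ← Complex.exp_neg]
  push_cast
  rw [Complex.two_cos]
  congr 2 <;> ring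

namespace HyperbolicTriple

variable (t : HyperbolicTriple)

/-- `m = lcm ({a, b, c} ∖ {∞})`. -/
def m : ℕ := Nat.lcm (Nat.lcm (finPart t.a) (finPart t.b)) (finPart t.c)

lemma m_pos : 0 < t.m :=
  Nat.lcm_pos (Nat.lcm_pos (finPart_pos t.two_le_a) (finPart_pos t.two_le_b))
    (finPart_pos t.two_le_c)

instance : NeZero (2 * t.m) := ⟨by have := t.m_pos; omega⟩

/-! ### The field `K` and its Galois group -/

/-- The field `K = ℚ(ζ_{2a}, ζ_{2b}, ζ_{2c})`, as a subfield of `ℂ`. -/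
def K : IntermediateField ℚ ℂ :=
  IntermediateField.adjoin ℚ {zeta (2 * t.a), zeta (2 * t.b), zeta (2 * t.c)}

/-- The primitive root of unity `ζ_{2m} = exp (2πi / 2m)`. -/
def zeta2m : ℂ := zeta ((2 * t.m : ℕ) : ℕ∞)

lemma isPrimitiveRoot_zeta2m : IsPrimitiveRoot t.zeta2m (2 * t.m) := by
  rw [zeta2m, zeta_coe]
  exact Complex.isPrimitiveRoot_exp _ (NeZero.ne _)

lemma exists_primitiveRoot_mem {F : IntermediateField ℚ ℂ} {s : ℕ∞} (hs : 2 ≤ s)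
    (h : zeta (2 * s) ∈ F) : ∃ z ∈ F, IsPrimitiveRoot z (2 * finPart s) := by
  cases s with
  | top => exact ⟨-1, neg_mem (one_mem F), IsPrimitiveRoot.neg_one 0 (by norm_num)⟩
  | coe n =>
    have h2 : (2 : ℕ∞) * (n : ℕ∞) = ((2 * n : ℕ) : ℕ∞) := by push_cast; rfl
    have hn : 2 ≤ n := by exact_mod_cast hs
    refine ⟨_, h, ?_⟩
    rw [h2, zeta_coe]
    exact Complex.isPrimitiveRoot_exp _ (by omega)

lemma exists_primitiveRoot_lcm {F : IntermediateField ℚ ℂ} {k l : ℕ} (hk : 0 < k) (hl : 0 < l)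
    (h₁ : ∃ z ∈ F, IsPrimitiveRoot z k) (h₂ : ∃ z ∈ F, IsPrimitiveRoot z l) :
    ∃ z ∈ F, IsPrimitiveRoot z (Nat.lcm k l) := by
  obtain ⟨x, hx, hx'⟩ := h₁
  obtain ⟨y, hy, hy'⟩ := h₂
  exact ⟨_, mul_mem (pow_mem hx _) (pow_mem hy _),
    IsPrimitiveRoot.pow_mul_pow_lcm hx' hy' hk.ne' hl.ne'⟩

lemma zeta_mem_of_dvd {s : ℕ∞} (hs : 2 ≤ s) (hd : finPart s ∣ t.m) :
    zeta (2 * s) ∈ IntermediateField.adjoin ℚ {t.zeta2m} := by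
  cases s with
  | top =>
    have h : (2 : ℕ∞) * ⊤ = ⊤ := by simp
    rw [h, zeta_top]
    exact one_mem _
  | coe n =>
    have h2 : (2 : ℕ∞) * (n : ℕ∞) = ((2 * n : ℕ) : ℕ∞) := by push_cast; rfl
    have hn : 2 ≤ n := by exact_mod_cast hs
    have hd' : 2 * n ∣ 2 * t.m := Nat.mul_dvd_mul_left 2 hd
    have hp : IsPrimitiveRoot (zeta (2 * (n : ℕ∞))) (2 * n) := by
      rw [h2, zeta_coe]
      exact Complex.isPrimitiveRoot_exp _ (by omega)
    obtain ⟨i, -, hi⟩ := t.isPrimitiveRoot_zeta2m.eq_pow_of_pow_eq_one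
      ((hp.pow_eq_one_iff_dvd _).2 hd')
    rw [← hi]
    exact pow_mem (IntermediateField.mem_adjoin_simple_self ℚ _) _

lemma zeta2m_mem : t.zeta2m ∈ t.K := by
  have ha := finPart_pos t.two_le_a
  have hb := finPart_pos t.two_le_b
  have hc := finPart_pos t.two_le_c
  have h₁ := exists_primitiveRoot_lcm (F := t.K) (by omega) (by omega)
    (exists_primitiveRoot_mem t.two_le_a (IntermediateField.subset_adjoin ℚ _ (by simp)))
    (exists_primitiveRoot_mem t.two_le_b (IntermediateField.subset_adjoin ℚ _ (by simp)))
  have h₂ := exists_primitiveRoot_lcm (F := t.K) (Nat.lcm_pos (by omega) (by omega)) (by omega) h₁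
    (exists_primitiveRoot_mem t.two_le_c (IntermediateField.subset_adjoin ℚ _ (by simp)))
  rw [Nat.lcm_mul_left, Nat.lcm_mul_left] at h₂
  obtain ⟨z, hz, hz'⟩ : ∃ z ∈ t.K, IsPrimitiveRoot z (2 * t.m) := h₂
  have : NeZero (2 * t.m) := inferInstance
  obtain ⟨i, -, hi⟩ := hz'.eq_pow_of_pow_eq_one t.isPrimitiveRoot_zeta2m.pow_eq_one
  rw [← hi]
  exact pow_mem hz _

lemma K_eq : t.K = IntermediateField.adjoin ℚ {t.zeta2m} := by
  apply le_antisymm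
  · rw [K, IntermediateField.adjoin_le_iff]
    have ha : finPart t.a ∣ t.m := (Nat.dvd_lcm_left _ _).trans (Nat.dvd_lcm_left _ _)
    have hb : finPart t.b ∣ t.m := (Nat.dvd_lcm_right _ _).trans (Nat.dvd_lcm_left _ _)
    have hc : finPart t.c ∣ t.m := Nat.dvd_lcm_right _ _
    rintro x (rfl | rfl | rfl)
    · exact t.zeta_mem_of_dvd t.two_le_a ha
    · exact t.zeta_mem_of_dvd t.two_le_b hb
    · exact t.zeta_mem_of_dvd t.two_le_c hc
  · rw [IntermediateField.adjoin_simple_le_iff]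
    exact t.zeta2m_mem

instance : IsCyclotomicExtension {2 * t.m} ℚ t.K := by
  rw [K_eq]
  have hint : IsIntegral ℚ t.zeta2m :=
    (t.isPrimitiveRoot_zeta2m.isIntegral (NeZero.pos _)).tower_top
  change IsCyclotomicExtension {2 * t.m} ℚ (IntermediateField.adjoin ℚ {t.zeta2m}).toSubalgebra
  rw [IntermediateField.adjoin_simple_toSubalgebra_of_isAlgebraic hint.isAlgebraic]
  exact t.isPrimitiveRoot_zeta2m.adjoin_isCyclotomicExtension ℚ

/-- The isomorphism `(ℤ/2mℤ)ˣ ≃ Gal(K/ℚ)`, `k ↦ σ_k`, where `σ_k(ζ_{2m}) = ζ_{2m} ^ k`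
(see `sigma_zeta2m`). -/
def sigma : (ZMod (2 * t.m))ˣ ≃* (t.K ≃ₐ[ℚ] t.K) :=
  (IsCyclotomicExtension.autEquivPow t.K
    (Polynomial.cyclotomic.irreducible_rat (NeZero.pos (2 * t.m)))).symm

lemma sigma_zeta2m (k : (ZMod (2 * t.m))ˣ) :
    t.sigma k ⟨t.zeta2m, t.zeta2m_mem⟩ = ⟨t.zeta2m, t.zeta2m_mem⟩ ^ (k : ZMod (2 * t.m)).val := by
  have hirr := Polynomial.cyclotomic.irreducible_rat (NeZero.pos (2 * t.m))
  have hμ : IsPrimitiveRoot (⟨t.zeta2m, t.zeta2m_mem⟩ : t.K) (2 * t.m) :=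
    IsPrimitiveRoot.coe_submonoidClass_iff.mp t.isPrimitiveRoot_zeta2m
  have hz := IsCyclotomicExtension.zeta_spec (2 * t.m) ℚ t.K
  have h1 : IsCyclotomicExtension.autEquivPow t.K hirr (t.sigma k) = k :=
    MulEquiv.apply_symm_apply _ k
  have h2 := hz.autToPow_spec ℚ (t.sigma k)
  have h3 : hz.autToPow ℚ (t.sigma k) = k := h1
  rw [h3] at h2
  obtain ⟨i, -, hi⟩ := hz.eq_pow_of_pow_eq_one hμ.pow_eq_one
  rw [← hi, map_pow, ← h2, pow_right_comm]

/-- `β = λ_a + λ_b + λ_c + λ_{2a} λ_{2b} λ_{2c} + 2`, a real number. -/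
def beta : ℝ :=
  lam t.a + lam t.b + lam t.c + lam (2 * t.a) * lam (2 * t.b) * lam (2 * t.c) + 2

lemma beta_mem : (t.beta : ℂ) ∈ t.K := by
  have ha : zeta (2 * t.a) ∈ t.K := IntermediateField.subset_adjoin ℚ _ (by simp)
  have hb : zeta (2 * t.b) ∈ t.K := IntermediateField.subset_adjoin ℚ _ (by simp)
  have hc : zeta (2 * t.c) ∈ t.K := IntermediateField.subset_adjoin ℚ _ (by simp)
  have h2 : ∀ s : ℕ∞, zeta (2 * s) ∈ t.K → (lam (2 * s) : ℂ) ∈ t.K := fun s hs => by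
    rw [lam_eq]
    exact add_mem hs (inv_mem hs)
  have h1 : ∀ s : ℕ∞, zeta (2 * s) ∈ t.K → (lam s : ℂ) ∈ t.K := fun s hs => by
    rw [lam_eq, ← zeta_two_mul_sq]
    exact add_mem (pow_mem hs 2) (inv_mem (pow_mem hs 2))
  rw [beta]
  push_cast
  exact add_mem (add_mem (add_mem (add_mem (h1 _ ha) (h1 _ hb)) (h1 _ hc))
    (mul_mem (mul_mem (h2 _ ha) (h2 _ hb)) (h2 _ hc))) (ofNat_mem t.K 2)

/-- The complex number `σ_k(β)`. -/
def sigmaBeta (k : (ZMod (2 * t.m))ˣ) : ℂ := (t.sigma k ⟨(t.beta : ℂ), t.beta_mem⟩ : t.K)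

/-- `cos (kπ / s)`, for `s` one of `a, b, c`; it equals `1` for `s = ∞`.  Since `2s ∣ 2m` when `s`
is finite, it does not depend on the integer chosen to represent `k ∈ (ℤ/2mℤ)ˣ`. -/
def cosK (k : (ZMod (2 * t.m))ˣ) (s : ℕ∞) : ℝ :=
  Real.cos ((k : ZMod (2 * t.m)).val * Real.pi * recip s)

/-- The curvature `κ(a, b, c; k)`. -/
def kappa (k : (ZMod (2 * t.m))ˣ) : ℝ :=
  1 - (t.cosK k t.a ^ 2 + t.cosK k t.b ^ 2 + t.cosK k t.c ^ 2
    + 2 * t.cosK k t.a * t.cosK k t.b * t.cosK k t.c)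

end HyperbolicTriple

/-! ### Hyperbolic triangles and triangle groups -/

/-- A triangle in the hyperbolic plane with angles `π/a`, `π/b`, `π/c` (a vertex with angle
`π/∞ = 0` being a point at infinity), given by its three sides.

`GL₂(ℝ)` acts on the upper half-plane by isometries, matrices of negative determinant acting by
`z ↦ (p z̄ + q) / (r z̄ + s)`.  A matrix `N = (p, q; r, -p)` of trace `0` and determinant `-1` acts as
the reflection in the geodesic `r |z|² - 2 p Re z - q = 0`.  The space of real matrices of trace `0`
with the form `(X, Y) ↦ tr (X Y) / 2` is a Lorentzian space of signature `(2, 1)`, and such an `N`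
is a unit normal vector of its geodesic; `N` and `-N` are the two unit normals, belonging to the two
half-planes which the geodesic bounds.  Two half-planes with outward unit normals `N`, `N'` meet in
a sector with interior angle `θ` if and only if `(N, N') = - cos θ`, where `θ = 0` means that the
bounding geodesics have a common endpoint at infinity.

Here `na`, `nb`, `nc` are the outward unit normals of the sides opposite to the vertices with angles
`π/a`, `π/b`, `π/c`. -/
structure Triangle (t : HyperbolicTriple) where
  na : GL (Fin 2) ℝ
  nb : GL (Fin 2) ℝ
  nc : GL (Fin 2) ℝ
  trace_na : (na : Matrix (Fin 2) (Fin 2) ℝ).trace = 0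
  trace_nb : (nb : Matrix (Fin 2) (Fin 2) ℝ).trace = 0
  trace_nc : (nc : Matrix (Fin 2) (Fin 2) ℝ).trace = 0
  det_na : (na : Matrix (Fin 2) (Fin 2) ℝ).det = -1
  det_nb : (nb : Matrix (Fin 2) (Fin 2) ℝ).det = -1
  det_nc : (nc : Matrix (Fin 2) (Fin 2) ℝ).det = -1
  angle_a : ((nb * nc : GL (Fin 2) ℝ) : Matrix (Fin 2) (Fin 2) ℝ).trace / 2
    = -Real.cos (Real.pi * recip t.a)
  angle_b : ((nc * na : GL (Fin 2) ℝ) : Matrix (Fin 2) (Fin 2) ℝ).trace / 2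
    = -Real.cos (Real.pi * recip t.b)
  angle_c : ((na * nb : GL (Fin 2) ℝ) : Matrix (Fin 2) (Fin 2) ℝ).trace / 2
    = -Real.cos (Real.pi * recip t.c)

lemma exists_normals {x y z : ℝ} (hz0 : 0 ≤ z) (hz : z ≤ 1)
    (h : 0 < x ^ 2 + y ^ 2 + z ^ 2 + 2 * x * y * z - 1) :
    ∃ p q r p' q' r' : ℝ, p ^ 2 + q * r = 1 ∧ p' ^ 2 + q' * r' = 1 ∧ p = -z ∧ p' = -y ∧
      2 * p * p' + q * r' + r * q' = -2 * x := by
  rcases eq_or_lt_of_le hz with rfl | hz'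
  · have hxy : x + y ≠ 0 := by
      intro h0
      have : x ^ 2 + y ^ 2 + 1 ^ 2 + 2 * x * y * 1 - 1 = (x + y) ^ 2 := by ring
      rw [this, h0] at h
      norm_num at h
    refine ⟨-1, 1, 0, -y, (1 - y ^ 2) / (-2 * (x + y)), -2 * (x + y), by ring, ?_, rfl, rfl, by ring⟩
    field_simp
    ring
  · have hs : 0 < 1 - z ^ 2 := by nlinarith
    have hs0 : Real.sqrt (1 - z ^ 2) ≠ 0 := (Real.sqrt_pos.2 hs).ne'
    have hs2 := Real.sq_sqrt hs.le
    have hd2 := Real.sq_sqrt h.le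
    set s := Real.sqrt (1 - z ^ 2)
    set d := Real.sqrt (x ^ 2 + y ^ 2 + z ^ 2 + 2 * x * y * z - 1)
    refine ⟨-z, s, s, -y, (-(x + y * z) + d) / s, (-(x + y * z) - d) / s, by linear_combination hs2,
      ?_, rfl, rfl, ?_⟩
    · field_simp
      linear_combination (y ^ 2 - 1) * hs2 - hd2
    · field_simp
      ring

lemma recip_nonneg (s : ℕ∞) : 0 ≤ recip s := by
  cases s with
  | top => exact le_refl (0 : ℝ)
  | coe n =>
    show (0 : ℝ) ≤ 1 / (n : ℝ)
    positivity

lemma recip_le {s : ℕ∞} (hs : 2 ≤ s) : recip s ≤ 1 / 2 := by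
  cases s with
  | top =>
    show (0 : ℝ) ≤ 1 / 2
    norm_num
  | coe n =>
    have hn : 2 ≤ n := by exact_mod_cast hs
    show 1 / (n : ℝ) ≤ 1 / 2
    exact one_div_le_one_div_of_le (by norm_num) (by exact_mod_cast hn)

/-- Every hyperbolic triple is the triple of a hyperbolic triangle. -/
theorem Triangle.nonempty (t : HyperbolicTriple) : Nonempty (Triangle t) := by
  have hpi := Real.pi_pos
  have bd : ∀ s : ℕ∞, 2 ≤ s → 0 ≤ Real.pi * recip s ∧ Real.pi * recip s ≤ Real.pi / 2 :=
    fun s hs => ⟨mul_nonneg hpi.le (recip_nonneg s), by nlinarith [recip_le hs]⟩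
  obtain ⟨a0, a1⟩ := bd _ t.two_le_a
  obtain ⟨b0, b1⟩ := bd _ t.two_le_b
  obtain ⟨c0, c1⟩ := bd _ t.two_le_c
  have hsum : Real.pi * recip t.a + Real.pi * recip t.b + Real.pi * recip t.c < Real.pi := by
    nlinarith [t.chi_neg]
  obtain ⟨p, q, r, p', q', r', h1, h2, h3, h4, h5⟩ :
      ∃ p q r p' q' r' : ℝ, p ^ 2 + q * r = 1 ∧ p' ^ 2 + q' * r' = 1 ∧
        p = -Real.cos (Real.pi * recip t.c) ∧ p' = -Real.cos (Real.pi * recip t.b) ∧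
        2 * p * p' + q * r' + r * q' = -2 * Real.cos (Real.pi * recip t.a) := by
    generalize Real.pi * recip t.a = A at *
    generalize Real.pi * recip t.b = B at *
    generalize Real.pi * recip t.c = C at *
    refine exists_normals (Real.cos_nonneg_of_neg_pi_div_two_le_of_le (by linarith) c1)
      (Real.cos_le_one _) ?_
    have e1 : 0 < Real.cos A + Real.cos (B + C) := by
      have := Real.cos_lt_cos_of_nonneg_of_le_pi (x := A) (y := Real.pi - (B + C)) a0
        (by linarith) (by linarith)
      rw [Real.cos_pi_sub] at this
      linarith
    have e2 : 0 ≤ Real.sin B * Real.sin C :=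
      mul_nonneg (Real.sin_nonneg_of_nonneg_of_le_pi b0 (by linarith))
        (Real.sin_nonneg_of_nonneg_of_le_pi c0 (by linarith))
    rw [Real.cos_add] at e1
    have e3 : 0 < Real.cos A + (Real.cos B * Real.cos C + Real.sin B * Real.sin C) := by linarith
    have e4 := mul_pos e1 e3
    have sB := Real.sin_sq_add_cos_sq B
    have sC := Real.sin_sq_add_cos_sq C
    have : (Real.cos A + (Real.cos B * Real.cos C - Real.sin B * Real.sin C))
        * (Real.cos A + (Real.cos B * Real.cos C + Real.sin B * Real.sin C))
        = Real.cos A ^ 2 + Real.cos B ^ 2 + Real.cos C ^ 2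
          + 2 * Real.cos A * Real.cos B * Real.cos C - 1 := by
      linear_combination (-(1 - Real.cos C ^ 2)) * sB - Real.sin B ^ 2 * sC
    linarith
  have d1 : (!![1, 0; 0, -1] : Matrix (Fin 2) (Fin 2) ℝ).det = -1 := by
    simp [Matrix.det_fin_two]
  have d2 : (!![p, q; r, -p] : Matrix (Fin 2) (Fin 2) ℝ).det = -1 := by
    simp [Matrix.det_fin_two]; linarith
  have d3 : (!![p', q'; r', -p'] : Matrix (Fin 2) (Fin 2) ℝ).det = -1 := by
    simp [Matrix.det_fin_two]; linarith
  exact ⟨{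
    na := Matrix.GeneralLinearGroup.mkOfDetNeZero !![1, 0; 0, -1] (by rw [d1]; norm_num)
    nb := Matrix.GeneralLinearGroup.mkOfDetNeZero !![p, q; r, -p] (by rw [d2]; norm_num)
    nc := Matrix.GeneralLinearGroup.mkOfDetNeZero !![p', q'; r', -p'] (by rw [d3]; norm_num)
    trace_na := by simp [Matrix.GeneralLinearGroup.mkOfDetNeZero, Matrix.trace_fin_two]
    trace_nb := by simp [Matrix.GeneralLinearGroup.mkOfDetNeZero, Matrix.trace_fin_two]
    trace_nc := by simp [Matrix.GeneralLinearGroup.mkOfDetNeZero, Matrix.trace_fin_two]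
    det_na := d1
    det_nb := d2
    det_nc := d3
    angle_a := by
      simp [Matrix.GeneralLinearGroup.mkOfDetNeZero, Matrix.trace_fin_two, Matrix.mul_apply,
        Fin.sum_univ_two]
      linarith
    angle_b := by
      simp [Matrix.GeneralLinearGroup.mkOfDetNeZero, Matrix.trace_fin_two, Matrix.mul_apply,
        Fin.sum_univ_two]
      linarith
    angle_c := by
      simp [Matrix.GeneralLinearGroup.mkOfDetNeZero, Matrix.trace_fin_two, Matrix.mul_apply,
        Fin.sum_univ_two]
      linarith }⟩

/-- The subgroup `Δ^{(2)}` of `SL₂(ℝ)` generated by `-1` and the squares of the elements of `Δ`. -/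
def squares (Δ : Subgroup SL(2, ℝ)) : Subgroup SL(2, ℝ) :=
  Subgroup.closure ({-1} ∪ {g | ∃ δ ∈ Δ, g = δ ^ 2})

/-- The invariant trace field `E = ℚ(Tr Δ^{(2)})`. -/
def invariantTraceField (Δ : Subgroup SL(2, ℝ)) : IntermediateField ℚ ℝ :=
  IntermediateField.adjoin ℚ
    {x | ∃ g ∈ squares Δ, x = (g : Matrix (Fin 2) (Fin 2) ℝ).trace}

/-- The invariant quaternion algebra `A`: the `E`-subalgebra of `M₂(ℝ)` generated by `Δ^{(2)}`. -/
def invariantAlgebra (Δ : Subgroup SL(2, ℝ)) :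
    Subalgebra (invariantTraceField Δ) (Matrix (Fin 2) (Fin 2) ℝ) :=
  Algebra.adjoin (invariantTraceField Δ) {x | ∃ g ∈ squares Δ, x = (g : Matrix (Fin 2) (Fin 2) ℝ)}

/-- An algebra `B` over a field `F` is split at an embedding `φ : F → ℝ` if
`ℝ ⊗_{φ, F} B ≃ M₂(ℝ)` as `ℝ`-algebras. -/
def IsSplitAt {F B : Type*} [Field F] [Ring B] [Algebra F B] (φ : F →+* ℝ) : Prop :=
  letI : Algebra F ℝ := φ.toAlgebra
  Nonempty (ℝ ⊗[F] B ≃ₐ[ℝ] Matrix (Fin 2) (Fin 2) ℝ)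

/-- The set of split real places of an algebra `B` over a field `F`. -/
def splitRealPlaces (F B : Type*) [Field F] [Ring B] [Algebra F B] :
    Set (NumberField.InfinitePlace F) :=
  {v | ∃ hv : v.IsReal, IsSplitAt (B := B) (NumberField.InfinitePlace.embedding_of_isReal hv)}

/-- The arithmetic dimension of `Δ`: the number of split real places of `A`. -/
def adim (Δ : Subgroup SL(2, ℝ)) : ℕ :=
  (splitRealPlaces (invariantTraceField Δ) (invariantAlgebra Δ)).ncard

namespace Triangle

variable {t : HyperbolicTriple} (T : Triangle t)

/-- The preimage in `SL₂(ℝ)` of the triangle group `Δ(a, b, c) ≤ PSL₂(ℝ)`, the group of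
orientation-preserving elements of the group generated by the reflections in the sides. -/
def group : Subgroup SL(2, ℝ) :=
  (Subgroup.closure {-1, T.na, T.nb, T.nc}).comap Matrix.SpecialLinearGroup.toGL

/-- The invariant trace field `E` of the triangle group, as a subfield of `K`. -/
def traceFieldInK : IntermediateField ℚ t.K :=
  ((invariantTraceField T.group).map (Complex.ofRealAm.restrictScalars ℚ)).comap t.K.val

/-- The group `H = Gal(K/E)`, as a subgroup of `(ℤ/2mℤ)ˣ ≃ Gal(K/ℚ)`. -/
def H : Subgroup (ZMod (2 * t.m))ˣ :=
  T.traceFieldInK.fixingSubgroup.comap t.sigma.toMonoidHom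

end Triangle

end TriangleGroup

end

open TriangleGroup

/-! Write `x, y, z` for the traces of the products `BC, CA, AB` of the reflections `A, B, C` in the
sides; they are `-λ_{2a}, -λ_{2b}, -λ_{2c}`. The plan is to present the invariant algebra as an
explicit quaternion algebra over `E`, whose splitting at a real embedding is decided by the sign of
`β`.

A reflection squares to `1`, so `(BC)² = x BC - 1`, and hence `x BC` lies in the invariant algebra
although `BC` need not. Let `P = x(BC - CB)` and `Q = y(CA - AC)`, both of trace `0`. Every element
of the group has a nonzero multiple, with factor a square root of an element of `E`, in the algebra
generated by `P` and `Q`, so its square lies there. This gives `E = ℚ(x², y², z², xyz)` and shows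
that `P, Q` generate the invariant algebra (`reflectionGroup_invariants`).

The commutator `j = PQ - QP` anticommutes with every combination `i = P + nQ`, and `j² = D = 16 x²
y² β`. One can take `n = 0` and `i² = x²(x² - 4)` unless this vanishes, in which case `D` is a
square (`exists_quaternion_adjoin`). The construction needs `x` and `y` nonzero. Hyperbolicity gives
`β > 0`, so at most one of the three traces is `0`, and a rotation of the labels moves it to `z`
(`group_invariants`).

Under `σ_k` each `λ_{2s}` becomes `2 cos(kπ/s)`, so `x²(x² - 4)` becomes nonpositive and `β` becomes
`-4κ` (`sigmaBeta_eq`). A real quaternion algebra `(α, D)` with `α < 0` is split exactly when `D >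
0`; if instead `D` is a nonzero square, it is split and `σ_k(D) > 0`. Either way splitting at `σ_k`
means `σ_k(β) > 0` (`place_mem_splitRealPlaces_iff`).

Finally, every complex embedding of `E` extends to the normal field `K`, so it is the restriction of
some `σ_k`; these restrictions are real and are classified by `k` modulo `H`. Thus classes
correspond to places, and the count follows (`adim_eq`). -/

open TriangleGroup

/-! ### Quaternion algebras: base change and splitting over the real numbers. -/

namespace TriangleGroup

open QuaternionAlgebra

section Quaternion

open scoped Quaternion

variable (F R : Type*) [CommRing F] [CommRing R] [Algebra F R] (x y : F)

/-- The quaternionic basis over `F` of a quaternion algebra over an `F`-algebra `R`. -/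
def restrictBasis : Basis ℍ[R, algebraMap F R x, 0, algebraMap F R y] x 0 y where
  i := ⟨0, 1, 0, 0⟩
  j := ⟨0, 0, 1, 0⟩
  k := ⟨0, 0, 0, 1⟩
  i_mul_i := by ext <;> simp [Algebra.algebraMap_eq_smul_one]
  j_mul_j := by ext <;> simp [Algebra.algebraMap_eq_smul_one]
  i_mul_j := by ext <;> simp
  j_mul_i := by ext <;> simp

/-- The quaternionic basis of the base change of a quaternion algebra. -/
def tensorBasis : Basis (R ⊗[F] ℍ[F, x, 0, y]) (algebraMap F R x) 0 (algebraMap F R y) where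
  i := 1 ⊗ₜ ⟨0, 1, 0, 0⟩
  j := 1 ⊗ₜ ⟨0, 0, 1, 0⟩
  k := 1 ⊗ₜ ⟨0, 0, 0, 1⟩
  i_mul_i := by
    rw [algebraMap_smul, zero_smul, add_zero, Algebra.TensorProduct.tmul_mul_tmul, one_mul,
      Algebra.TensorProduct.one_def, ← TensorProduct.tmul_smul]
    congr 1
    ext <;> simp
  j_mul_j := by
    rw [algebraMap_smul, Algebra.TensorProduct.tmul_mul_tmul, one_mul,
      Algebra.TensorProduct.one_def, ← TensorProduct.tmul_smul]
    congr 1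
    ext <;> simp
  i_mul_j := by
    rw [Algebra.TensorProduct.tmul_mul_tmul, one_mul]
    congr 1
    ext <;> simp
  j_mul_i := by
    rw [Algebra.TensorProduct.tmul_mul_tmul, one_mul, zero_smul, zero_sub,
      ← TensorProduct.tmul_neg]
    congr 1
    ext <;> simp

/-- The map from the base change of a quaternion algebra to the quaternion algebra with the same
constants. -/
noncomputable def quaternionBaseChangeHom :
    R ⊗[F] ℍ[F, x, 0, y] →ₐ[R] ℍ[R, algebraMap F R x, 0, algebraMap F R y] :=
  Algebra.TensorProduct.lift (Algebra.ofId R _) (restrictBasis F R x y).liftHom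
    (fun r _ => by rw [Algebra.ofId_apply]; exact Algebra.commute_algebraMap_left r _)

lemma quaternionBaseChangeHom_one_tmul (q : ℍ[F, x, 0, y]) :
    quaternionBaseChangeHom F R x y (1 ⊗ₜ q) = (restrictBasis F R x y).lift q := by
  rw [quaternionBaseChangeHom, Algebra.TensorProduct.lift_tmul, map_one, one_mul]
  rfl

/-- The base change of a quaternion algebra is the quaternion algebra with the same constants. -/
noncomputable def quaternionBaseChange :
    R ⊗[F] ℍ[F, x, 0, y] ≃ₐ[R] ℍ[R, algebraMap F R x, 0, algebraMap F R y] :=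
  AlgEquiv.ofAlgHom (quaternionBaseChangeHom F R x y) (tensorBasis F R x y).liftHom
    (by
      apply QuaternionAlgebra.hom_ext
      · have h : (tensorBasis F R x y).liftHom (Basis.self R).i = 1 ⊗ₜ ⟨0, 1, 0, 0⟩ := by
          simp [Basis.lift, tensorBasis]
        rw [AlgHom.comp_apply, h, quaternionBaseChangeHom_one_tmul]
        simp [Basis.lift, restrictBasis]
      · have h : (tensorBasis F R x y).liftHom (Basis.self R).j = 1 ⊗ₜ ⟨0, 0, 1, 0⟩ := by
          simp [Basis.lift, tensorBasis]
        rw [AlgHom.comp_apply, h, quaternionBaseChangeHom_one_tmul]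
        simp [Basis.lift, restrictBasis])
    (by
      apply Algebra.TensorProduct.ext
      · ext
      · apply QuaternionAlgebra.hom_ext
        · show (tensorBasis F R x y).liftHom
            (quaternionBaseChangeHom F R x y (1 ⊗ₜ (Basis.self F).i)) = 1 ⊗ₜ (Basis.self F).i
          rw [quaternionBaseChangeHom_one_tmul]
          simp [Basis.lift, restrictBasis, tensorBasis]
        · show (tensorBasis F R x y).liftHom
            (quaternionBaseChangeHom F R x y (1 ⊗ₜ (Basis.self F).j)) = 1 ⊗ₜ (Basis.self F).j
          rw [quaternionBaseChangeHom_one_tmul]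
          simp [Basis.lift, restrictBasis, tensorBasis])

/-- A real quaternion algebra whose second constant is positive is a matrix algebra. -/
theorem nonempty_quaternion_equiv_matrix {x y : ℝ} (hx : x ≠ 0) (hy : 0 < y) :
    Nonempty (ℍ[ℝ, x, 0, y] ≃ₐ[ℝ] Matrix (Fin 2) (Fin 2) ℝ) := by
  obtain ⟨s, hs, rfl⟩ : ∃ s : ℝ, 0 < s ∧ y = s * s :=
    ⟨Real.sqrt y, Real.sqrt_pos.2 hy, (Real.mul_self_sqrt hy.le).symm⟩
  -- With `y = s²`, let `j` be diagonal with eigenvalues `±s` and `i` the companion matrix of `T² -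
  -- x`. The resulting map is injective by comparing the four entries, hence bijective by dimension.
  let b : Basis (Matrix (Fin 2) (Fin 2) ℝ) x 0 (s * s) :=
    { i := !![0, x; 1, 0]
      j := !![s, 0; 0, -s]
      k := !![0, -(x * s); s, 0]
      i_mul_i := by ext i j; fin_cases i <;> fin_cases j <;> simp
      j_mul_j := by ext i j; fin_cases i <;> fin_cases j <;> simp
      i_mul_j := by ext i j; fin_cases i <;> fin_cases j <;> simp
      j_mul_i := by ext i j; fin_cases i <;> fin_cases j <;> simp [mul_comm] }
  have hinj : Function.Injective b.liftHom := by
    rw [injective_iff_map_eq_zero]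
    intro q hq
    have h : ∀ i j, b.liftHom q i j = 0 := fun i j => by rw [hq]; rfl
    have h00 := h 0 0
    have h01 := h 0 1
    have h10 := h 1 0
    have h11 := h 1 1
    simp [b, Basis.lift, Matrix.algebraMap_matrix_apply] at h00 h01 h10 h11
    have e0 : q.re = 0 := by linarith
    have e1 : q.imJ = 0 := by
      have : q.imJ * s = 0 := by linarith
      simpa [hs.ne'] using this
    have e2 : q.imI = q.imK * s := by
      have : x * (q.imI - q.imK * s) = 0 := by linarith
      have := (mul_eq_zero.1 this).resolve_left hx
      linarith
    have e3 : q.imK = 0 := by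
      have : q.imK * s = 0 := by linarith
      simpa [hs.ne'] using this
    ext <;> simp [e0, e1, e2, e3]
  have hd : Module.finrank ℝ ℍ[ℝ, x, 0, s * s] = Module.finrank ℝ (Matrix (Fin 2) (Fin 2) ℝ) := by
    rw [QuaternionAlgebra.finrank_eq_four, Module.finrank_matrix]
    simp
  exact ⟨AlgEquiv.ofBijective b.liftHom ⟨hinj,
    (LinearMap.injective_iff_surjective_of_finrank_eq_finrank
      (f := b.liftHom.toLinearMap) hd).1 hinj⟩⟩

/-- A real quaternion algebra with negative constants is not a matrix algebra. -/
theorem isEmpty_quaternion_equiv_matrix {x y : ℝ} (hx : x < 0) (hy : y < 0) :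
    IsEmpty (ℍ[ℝ, x, 0, y] ≃ₐ[ℝ] Matrix (Fin 2) (Fin 2) ℝ) := by
  refine ⟨fun e => ?_⟩
  -- The obstruction is a nonzero nilpotent: with both constants negative, the norm form is positive
  -- definite and `q² = 0` forces `q = 0`.
  have hN : (!![0, 1; 0, 0] : Matrix (Fin 2) (Fin 2) ℝ) * !![0, 1; 0, 0] = 0 := by
    ext i j; fin_cases i <;> fin_cases j <;> simp
  set q := e.symm !![0, 1; 0, 0] with hq
  have hqq : q * q = 0 := by rw [hq, ← map_mul, hN, map_zero]
  have h0 := congrArg QuaternionAlgebra.re hqq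
  have h1 := congrArg QuaternionAlgebra.imI hqq
  have h2 := congrArg QuaternionAlgebra.imJ hqq
  have h3 := congrArg QuaternionAlgebra.imK hqq
  simp at h0 h1 h2 h3
  have hxy : 0 < x * y := mul_pos_of_neg_of_neg hx hy
  have i1 : q.re * q.imI = 0 := by linarith
  have i2 : q.re * q.imJ = 0 := by linarith
  have i3 : q.re * q.imK = 0 := by linarith
  have key : q.re = 0 ∧ q.imI = 0 ∧ q.imJ = 0 ∧ q.imK = 0 := by
    by_cases hr : q.re = 0
    · rw [hr] at h0
      have p1 : 0 ≤ -x * (q.imI * q.imI) := mul_nonneg (by linarith) (mul_self_nonneg _)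
      have p2 : 0 ≤ -y * (q.imJ * q.imJ) := mul_nonneg (by linarith) (mul_self_nonneg _)
      have p3 : 0 ≤ x * y * (q.imK * q.imK) := mul_nonneg hxy.le (mul_self_nonneg _)
      have z1 : -x * (q.imI * q.imI) = 0 := by linarith
      have z2 : -y * (q.imJ * q.imJ) = 0 := by linarith
      have z3 : x * y * (q.imK * q.imK) = 0 := by linarith
      simp only [mul_eq_zero, neg_eq_zero, hx.ne, hy.ne, false_or, or_self] at z1 z2 z3
      exact ⟨hr, z1, z2, z3⟩
    · have j1 := (mul_eq_zero.1 i1).resolve_left hr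
      have j2 := (mul_eq_zero.1 i2).resolve_left hr
      have j3 := (mul_eq_zero.1 i3).resolve_left hr
      rw [j1, j2, j3] at h0
      exact absurd (mul_self_eq_zero.1 (by linarith)) hr
  have hq0 : q = 0 := by ext <;> simp [key]
  have := congrArg e hq0
  rw [hq, AlgEquiv.apply_symm_apply, map_zero] at this
  simpa using congrFun (congrFun this 0) 1

theorem isSplitAt_congr {F B B' : Type*} [Field F] [Ring B] [Algebra F B] [Ring B'] [Algebra F B']
    (e : B ≃ₐ[F] B') (φ : F →+* ℝ) : IsSplitAt (B := B) φ ↔ IsSplitAt (B := B') φ := by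
  let : Algebra F ℝ := φ.toAlgebra
  have E : ℝ ⊗[F] B ≃ₐ[ℝ] ℝ ⊗[F] B' := Algebra.TensorProduct.congr AlgEquiv.refl e
  exact ⟨fun ⟨f⟩ => ⟨E.symm.trans f⟩, fun ⟨f⟩ => ⟨E.trans f⟩⟩

/-- A real quaternion algebra is nonsplit only when both constants are negative. The hypothesis `h`
excludes the case `φ x > 0 > φ y`, so the sign of `φ y` alone decides. -/
theorem isSplitAt_quaternion_iff {F : Type*} [Field F] {x y : F} (hx : x ≠ 0) (hy : y ≠ 0)
    (φ : F →+* ℝ) (h : φ y < 0 → φ x < 0) :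
    IsSplitAt (B := ℍ[F, x, 0, y]) φ ↔ 0 < φ y := by
  let : Algebra F ℝ := φ.toAlgebra
  have E : ℝ ⊗[F] ℍ[F, x, 0, y] ≃ₐ[ℝ] ℍ[ℝ, φ x, 0, φ y] := quaternionBaseChange F ℝ x y
  constructor
  · rintro ⟨f⟩
    by_contra hn
    have hy' : φ y < 0 := lt_of_le_of_ne (not_lt.1 hn) ((map_ne_zero φ).2 hy)
    exact (isEmpty_quaternion_equiv_matrix (h hy') hy').false (E.symm.trans f)
  · intro hpos
    obtain ⟨f⟩ := nonempty_quaternion_equiv_matrix ((map_ne_zero φ).2 hx) hpos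
    exact ⟨E.trans f⟩

end Quaternion

end TriangleGroup

/-! ### Quaternionic bases inside the real matrix algebra. -/

namespace TriangleGroup

open QuaternionAlgebra

section QuaternionicBasis

open scoped Quaternion

variable {R : Type*} [Field R] [Algebra R ℝ] {x y : R}

/-- Since `i` and `j` anticommute, cyclicity gives `tr(j² i) = -tr(j² i)`, and `j²` is the nonzero
scalar `y`. -/
lemma trace_quaternion_i (b : Basis (Matrix (Fin 2) (Fin 2) ℝ) x 0 y) (hy : y ≠ 0) :
    b.i.trace = 0 := by
  have hji : b.j * b.i = -(b.i * b.j) := by rw [b.j_mul_i, b.i_mul_j, zero_smul, zero_sub]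
  have h1 : (b.j * b.j * b.i).trace = -(b.j * b.j * b.i).trace := by
    conv_lhs => rw [mul_assoc, hji, mul_neg, Matrix.trace_neg, ← mul_assoc, Matrix.trace_mul_comm,
      ← mul_assoc]
  have h2 : (b.j * b.j * b.i).trace = 0 := by linarith
  rw [b.j_mul_j, smul_mul_assoc, one_mul, Matrix.trace_smul, Algebra.smul_def] at h2
  exact (mul_eq_zero.1 h2).resolve_left ((map_ne_zero _).2 hy)

lemma trace_quaternion_j (b : Basis (Matrix (Fin 2) (Fin 2) ℝ) x 0 y) (hx : x ≠ 0) :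
    b.j.trace = 0 := by
  have hji : b.i * b.j = -(b.j * b.i) := by
    rw [b.j_mul_i, b.i_mul_j, zero_smul, zero_sub, neg_neg]
  have h1 : (b.i * b.i * b.j).trace = -(b.i * b.i * b.j).trace := by
    conv_lhs => rw [mul_assoc, hji, mul_neg, Matrix.trace_neg, ← mul_assoc, Matrix.trace_mul_comm,
      ← mul_assoc]
  have h2 : (b.i * b.i * b.j).trace = 0 := by linarith
  rw [b.i_mul_i, zero_smul, add_zero, smul_mul_assoc, one_mul, Matrix.trace_smul,
    Algebra.smul_def] at h2
  exact (mul_eq_zero.1 h2).resolve_left ((map_ne_zero _).2 hx)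

lemma trace_quaternion_k (b : Basis (Matrix (Fin 2) (Fin 2) ℝ) x 0 y) : b.k.trace = 0 := by
  have hji : b.j * b.i = -b.k := by rw [b.j_mul_i, zero_smul, zero_sub]
  have h := Matrix.trace_mul_comm b.i b.j
  rw [hji, b.i_mul_j, Matrix.trace_neg] at h
  linarith

lemma trace_quaternion (b : Basis (Matrix (Fin 2) (Fin 2) ℝ) x 0 y) (hx : x ≠ 0) (hy : y ≠ 0)
    (q : ℍ[R, x, 0, y]) : (b.liftHom q).trace = 2 * algebraMap R ℝ q.re := by
  rw [Basis.liftHom_apply, Basis.lift, Matrix.trace_add, Matrix.trace_add, Matrix.trace_add,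
    Matrix.trace_smul, Matrix.trace_smul, Matrix.trace_smul, trace_quaternion_i b hy,
    trace_quaternion_j b hx, trace_quaternion_k b, Algebra.algebraMap_eq_smul_one,
    Matrix.trace_smul, Matrix.trace_one, Algebra.smul_def]
  simp
  ring

lemma trace_quaternion_mul_i (b : Basis (Matrix (Fin 2) (Fin 2) ℝ) x 0 y) (hx : x ≠ 0)
    (hy : y ≠ 0) (q : ℍ[R, x, 0, y]) :
    (b.liftHom q * b.i).trace = 2 * algebraMap R ℝ (x * q.imI) := by
  have h : b.i = b.liftHom ⟨0, 1, 0, 0⟩ := by simp [Basis.lift]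
  rw [h, ← map_mul, trace_quaternion b hx hy]
  simp

lemma trace_quaternion_mul_j (b : Basis (Matrix (Fin 2) (Fin 2) ℝ) x 0 y) (hx : x ≠ 0)
    (hy : y ≠ 0) (q : ℍ[R, x, 0, y]) :
    (b.liftHom q * b.j).trace = 2 * algebraMap R ℝ (y * q.imJ) := by
  have h : b.j = b.liftHom ⟨0, 0, 1, 0⟩ := by simp [Basis.lift]
  rw [h, ← map_mul, trace_quaternion b hx hy]
  simp

lemma trace_quaternion_mul_k (b : Basis (Matrix (Fin 2) (Fin 2) ℝ) x 0 y) (hx : x ≠ 0)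
    (hy : y ≠ 0) (q : ℍ[R, x, 0, y]) :
    (b.liftHom q * b.k).trace = 2 * algebraMap R ℝ (-(x * y * q.imK)) := by
  have h : b.k = b.liftHom ⟨0, 0, 0, 1⟩ := by simp [Basis.lift]
  rw [h, ← map_mul, trace_quaternion b hx hy]
  simp

/-- The traces of the products with `1, i, j, k` recover the four coordinates up to nonzero factors.
-/
lemma quaternion_liftHom_injective (b : Basis (Matrix (Fin 2) (Fin 2) ℝ) x 0 y) (hx : x ≠ 0)
    (hy : y ≠ 0) : Function.Injective b.liftHom := by
  rw [injective_iff_map_eq_zero]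
  intro q hq
  have h0 := trace_quaternion b hx hy q
  have h1 := trace_quaternion_mul_i b hx hy q
  have h2 := trace_quaternion_mul_j b hx hy q
  have h3 := trace_quaternion_mul_k b hx hy q
  rw [hq] at h0 h1 h2 h3
  simp [hx, hy] at h0 h1 h2 h3
  ext <;> simp [h0, h1, h2, h3]

/-- The extension of scalars of a quaternionic basis of the ring of real matrices. -/
noncomputable def realBasis (b : Basis (Matrix (Fin 2) (Fin 2) ℝ) x 0 y) :
    Basis (Matrix (Fin 2) (Fin 2) ℝ) (algebraMap R ℝ x) 0 (algebraMap R ℝ y) where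
  i := b.i
  j := b.j
  k := b.k
  i_mul_i := by rw [b.i_mul_i, algebraMap_smul, zero_smul, zero_smul]
  j_mul_j := by rw [b.j_mul_j, algebraMap_smul]
  i_mul_j := b.i_mul_j
  j_mul_i := by rw [b.j_mul_i, zero_smul, zero_smul]

/-- A real matrix belongs to a quaternion algebra over a subfield if its products with a
quaternionic basis have traces in the subfield. -/
lemma mem_range_liftHom (b : Basis (Matrix (Fin 2) (Fin 2) ℝ) x 0 y) (hx : x ≠ 0)
    (hy : y ≠ 0) (M : Matrix (Fin 2) (Fin 2) ℝ) {s₀ s₁ s₂ s₃ : R}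
    (h0 : M.trace = algebraMap R ℝ s₀) (h1 : (M * b.i).trace = algebraMap R ℝ s₁)
    (h2 : (M * b.j).trace = algebraMap R ℝ s₂) (h3 : (M * b.k).trace = algebraMap R ℝ s₃) :
    M ∈ b.liftHom.range := by
  have hx' : algebraMap R ℝ x ≠ 0 := (map_ne_zero _).2 hx
  have hy' : algebraMap R ℝ y ≠ 0 := (map_ne_zero _).2 hy
  have hd : Module.finrank ℝ ℍ[ℝ, algebraMap R ℝ x, 0, algebraMap R ℝ y]
      = Module.finrank ℝ (Matrix (Fin 2) (Fin 2) ℝ) := by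
    rw [QuaternionAlgebra.finrank_eq_four, Module.finrank_matrix]
    simp
  -- By dimension the basis spans all matrices over `ℝ`, so `M` has real coordinates; the four
  -- traces then show that these coordinates come from `R`.
  obtain ⟨q, rfl⟩ := (LinearMap.injective_iff_surjective_of_finrank_eq_finrank
      (f := (realBasis b).liftHom.toLinearMap) hd).1
      (quaternion_liftHom_injective (realBasis b) hx' hy') M
  change ((realBasis b).liftHom q).trace = _ at h0
  change ((realBasis b).liftHom q * (realBasis b).i).trace = _ at h1
  change ((realBasis b).liftHom q * (realBasis b).j).trace = _ at h2
  change ((realBasis b).liftHom q * (realBasis b).k).trace = _ at h3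
  rw [trace_quaternion _ hx' hy'] at h0
  rw [trace_quaternion_mul_i _ hx' hy'] at h1
  rw [trace_quaternion_mul_j _ hx' hy'] at h2
  rw [trace_quaternion_mul_k _ hx' hy'] at h3
  simp only [Algebra.algebraMap_self, RingHom.id_apply] at h0 h1 h2 h3
  have e0 : q.re = algebraMap R ℝ (s₀ / 2) := by
    rw [map_div₀, map_ofNat, ← h0]
    ring
  have e1 : q.imI = algebraMap R ℝ (s₁ / (2 * x)) := by
    rw [map_div₀, map_mul, map_ofNat, ← h1]
    field_simp
  have e2 : q.imJ = algebraMap R ℝ (s₂ / (2 * y)) := by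
    rw [map_div₀, map_mul, map_ofNat, ← h2]
    field_simp
  have e3 : q.imK = algebraMap R ℝ (-(s₃ / (2 * x * y))) := by
    rw [map_neg, map_div₀, map_mul, map_mul, map_ofNat, ← h3]
    field_simp
  refine ⟨⟨s₀ / 2, s₁ / (2 * x), s₂ / (2 * y), -(s₃ / (2 * x * y))⟩, ?_⟩
  change b.lift _ = (realBasis b).lift q
  rw [Basis.lift, Basis.lift, e0, e1, e2, e3, algebraMap_smul, algebraMap_smul, algebraMap_smul,
    ← IsScalarTower.algebraMap_apply R ℝ]
  rfl

end QuaternionicBasis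

/-! ### Algebras generated by two matrices of trace zero. -/

section Traceless

open scoped Quaternion

lemma eq_of_trace_eq_zero {M : Matrix (Fin 2) (Fin 2) ℝ} (h : M.trace = 0) :
    M = !![M 0 0, M 0 1; M 1 0, -M 0 0] := by
  rw [Matrix.trace_fin_two] at h
  have : M 1 1 = -M 0 0 := by linarith
  rw [← this]
  exact Matrix.eta_fin_two M

lemma exists_of_trace_eq_zero {M : Matrix (Fin 2) (Fin 2) ℝ} (h : M.trace = 0) :
    ∃ a b c : ℝ, M = !![a, b; c, -a] :=
  ⟨_, _, _, eq_of_trace_eq_zero h⟩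

lemma mul_self_of_trace_eq_zero {P : Matrix (Fin 2) (Fin 2) ℝ} (hP : P.trace = 0) :
    P * P = ((P * P).trace / 2) • 1 := by
  obtain ⟨a, b, c, rfl⟩ := exists_of_trace_eq_zero hP
  ext i j
  fin_cases i <;> fin_cases j <;> simp [Matrix.trace_fin_two] <;> ring

lemma mul_add_mul_of_trace_eq_zero {P Q : Matrix (Fin 2) (Fin 2) ℝ} (hP : P.trace = 0)
    (hQ : Q.trace = 0) : P * Q + Q * P = (P * Q).trace • 1 := by
  obtain ⟨a, b, c, rfl⟩ := exists_of_trace_eq_zero hP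
  obtain ⟨a', b', c', rfl⟩ := exists_of_trace_eq_zero hQ
  ext i j
  fin_cases i <;> fin_cases j <;> simp [Matrix.trace_fin_two] <;> ring

/-- On traceless matrices the commutator behaves like a cross product: its square is the scalar
given by minus the Gram determinant of `P, Q` for the trace form. This is the source of the second
constant of the quaternion algebra. -/
lemma commutator_mul_self {P Q : Matrix (Fin 2) (Fin 2) ℝ} (hP : P.trace = 0)
    (hQ : Q.trace = 0) : (P * Q - Q * P) * (P * Q - Q * P)
      = ((P * Q).trace ^ 2 - (P * P).trace * (Q * Q).trace) • 1 := by
  obtain ⟨a, b, c, rfl⟩ := exists_of_trace_eq_zero hP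
  obtain ⟨a', b', c', rfl⟩ := exists_of_trace_eq_zero hQ
  ext i j
  fin_cases i <;> fin_cases j <;> simp [Matrix.trace_fin_two] <;> ring

lemma commutator_anticomm {P Q : Matrix (Fin 2) (Fin 2) ℝ} (hP : P.trace = 0)
    (hQ : Q.trace = 0) : (P * Q - Q * P) * P = -(P * (P * Q - Q * P)) := by
  obtain ⟨a, b, c, rfl⟩ := exists_of_trace_eq_zero hP
  obtain ⟨a', b', c', rfl⟩ := exists_of_trace_eq_zero hQ
  ext i j
  fin_cases i <;> fin_cases j <;> simp <;> ring

lemma trace_mul_commutator (P Q : Matrix (Fin 2) (Fin 2) ℝ) :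
    (P * (P * Q - Q * P)).trace = 0 := by
  rw [mul_sub, Matrix.trace_sub, ← mul_assoc, ← mul_assoc, Matrix.trace_mul_cycle P Q P, sub_self]

lemma trace_mul_mul_commutator {P Q : Matrix (Fin 2) (Fin 2) ℝ} (hP : P.trace = 0)
    (hQ : Q.trace = 0) : (P * (Q * (P * Q - Q * P))).trace
      = (P * Q).trace ^ 2 - (P * P).trace * (Q * Q).trace := by
  obtain ⟨a, b, c, rfl⟩ := exists_of_trace_eq_zero hP
  obtain ⟨a', b', c', rfl⟩ := exists_of_trace_eq_zero hQ
  simp [Matrix.trace_fin_two]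
  ring

lemma trace_commutator_mul_commutator {A B C : Matrix (Fin 2) (Fin 2) ℝ} (hA : A.trace = 0)
    (hB : B.trace = 0) (hC : C.trace = 0) :
    ((B * C - C * B) * (C * A - A * C)).trace
      = 2 * (C * C).trace * (A * B).trace - 2 * (B * C).trace * (C * A).trace := by
  obtain ⟨a, b, c, rfl⟩ := exists_of_trace_eq_zero hA
  obtain ⟨a', b', c', rfl⟩ := exists_of_trace_eq_zero hB
  obtain ⟨a'', b'', c'', rfl⟩ := exists_of_trace_eq_zero hC
  simp [Matrix.trace_fin_two]
  ring

lemma coe_two (F : IntermediateField ℚ ℝ) : ((2 : F) : ℝ) = 2 := rfl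

lemma coe_four (F : IntermediateField ℚ ℝ) : ((4 : F) : ℝ) = 4 := rfl

variable {F : IntermediateField ℚ ℝ} {P Q : Matrix (Fin 2) (Fin 2) ℝ} (hP : P.trace = 0)
  (hQ : Q.trace = 0) {p q r : F} (hp : (P * P).trace = 2 * p) (hq : (Q * Q).trace = 2 * q)
  (hr : (P * Q).trace = r) (n : F)

include hP hQ hp hq hr in
lemma linear_comb_mul_self :
    (P + (n : ℝ) • Q) * (P + (n : ℝ) • Q) = ((p + n ^ 2 * q + n * r : F) : ℝ) • 1 := by
  have h1 := mul_self_of_trace_eq_zero hP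
  have h2 := mul_self_of_trace_eq_zero hQ
  have h3 := mul_add_mul_of_trace_eq_zero hP hQ
  rw [hp] at h1
  rw [hq] at h2
  rw [hr] at h3
  have : (P + (n : ℝ) • Q) * (P + (n : ℝ) • Q)
      = P * P + ((n : ℝ) ^ 2) • (Q * Q) + (n : ℝ) • (P * Q + Q * P) := by
    simp only [add_mul, mul_add, smul_mul_assoc, mul_smul_comm]
    module
  rw [this, h1, h2, h3]
  push_cast
  module

/-- The quaternionic basis `P + n Q, P Q - Q P` defined by two matrices `P, Q` of trace `0`. -/
noncomputable def pairBasis :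
    Basis (Matrix (Fin 2) (Fin 2) ℝ) (p + n ^ 2 * q + n * r) 0 (r ^ 2 - 4 * p * q) where
  i := P + (n : ℝ) • Q
  j := P * Q - Q * P
  k := (P + (n : ℝ) • Q) * (P * Q - Q * P)
  i_mul_i := by
    rw [linear_comb_mul_self hP hQ hp hq hr, zero_smul, add_zero]
    rfl
  j_mul_j := by
    rw [commutator_mul_self hP hQ, hp, hq, hr]
    change _ = ((r ^ 2 - 4 * p * q : F) : ℝ) • (1 : Matrix (Fin 2) (Fin 2) ℝ)
    congr 1
    push_cast [coe_four]
    ring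
  i_mul_j := rfl
  j_mul_i := by
    have h1 := commutator_anticomm hP hQ
    have h2 := commutator_anticomm hQ hP
    have h3 : (P * Q - Q * P) * Q = -(Q * (P * Q - Q * P)) := by
      rw [← neg_sub (Q * P), neg_mul, h2, mul_neg]
    rw [zero_smul, zero_sub, mul_add, add_mul, h1, mul_smul_comm, h3, smul_mul_assoc]
    module

/-- The basis is built from `P, Q` over `F`. Conversely, the traces of `P` and of `Q` against `1, i,
j, k` all lie in `F`, so `mem_range_liftHom` applies; the witnesses `s₀, …, s₃` are these traces. -/
lemma pairBasis_range (hα : p + n ^ 2 * q + n * r ≠ 0) (hD : r ^ 2 - 4 * p * q ≠ 0) :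
    (pairBasis hP hQ hp hq hr n).liftHom.range = Algebra.adjoin F {P, Q} := by
  have e1 : (P * (P * (P * Q - Q * P))).trace = 0 := by
    rw [← mul_assoc, mul_self_of_trace_eq_zero hP, smul_mul_assoc, one_mul, Matrix.trace_smul,
      Matrix.trace_sub, Matrix.trace_mul_comm P Q, sub_self, smul_zero]
  have e2 : (Q * (Q * (P * Q - Q * P))).trace = 0 := by
    rw [← mul_assoc, mul_self_of_trace_eq_zero hQ, smul_mul_assoc, one_mul, Matrix.trace_smul,
      Matrix.trace_sub, Matrix.trace_mul_comm P Q, sub_self, smul_zero]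
  have e3 := trace_mul_mul_commutator hP hQ
  have e4 := trace_mul_mul_commutator hQ hP
  have e5 := trace_mul_commutator P Q
  have e6 : (Q * (P * Q - Q * P)).trace = 0 := by
    rw [← neg_sub (Q * P), mul_neg, Matrix.trace_neg, trace_mul_commutator, neg_zero]
  apply le_antisymm
  · have hPm : P ∈ Algebra.adjoin F {P, Q} := Algebra.subset_adjoin (by simp)
    have hQm : Q ∈ Algebra.adjoin F {P, Q} := Algebra.subset_adjoin (by simp)
    have hi : P + (n : ℝ) • Q ∈ Algebra.adjoin F {P, Q} :=
      add_mem hPm (Subalgebra.smul_mem _ hQm n)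
    have hj : P * Q - Q * P ∈ Algebra.adjoin F {P, Q} :=
      sub_mem (mul_mem hPm hQm) (mul_mem hQm hPm)
    rw [Basis.range_liftHom, Algebra.adjoin_le_iff]
    rintro M (rfl | rfl | rfl)
    · exact hi
    · exact hj
    · exact mul_mem hi hj
  · rw [Algebra.adjoin_le_iff]
    refine Set.insert_subset ?_ (Set.singleton_subset_iff.2 ?_)
    · refine mem_range_liftHom _ hα hD _ (s₀ := 0) (s₁ := 2 * p + n * r) (s₂ := 0)
        (s₃ := n * (r ^ 2 - 4 * p * q)) (by simpa using hP) ?_ (by rw [map_zero]; exact e5) ?_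
      · change (P * (P + (n : ℝ) • Q)).trace = ((2 * p + n * r : F) : ℝ)
        rw [mul_add, mul_smul_comm, Matrix.trace_add, Matrix.trace_smul, hp, hr]
        push_cast [coe_two]
        rfl
      · change (P * ((P + (n : ℝ) • Q) * (P * Q - Q * P))).trace
          = ((n * (r ^ 2 - 4 * p * q) : F) : ℝ)
        rw [add_mul, mul_add, smul_mul_assoc, mul_smul_comm, Matrix.trace_add, Matrix.trace_smul,
          e1, e3, hp, hq, hr, smul_eq_mul]
        push_cast [coe_four]
        ring
    · refine mem_range_liftHom _ hα hD _ (s₀ := 0) (s₁ := r + 2 * n * q) (s₂ := 0)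
        (s₃ := -(r ^ 2 - 4 * p * q)) (by simpa using hQ) ?_ (by rw [map_zero]; exact e6) ?_
      · change (Q * (P + (n : ℝ) • Q)).trace = ((r + 2 * n * q : F) : ℝ)
        rw [mul_add, mul_smul_comm, Matrix.trace_add, Matrix.trace_smul, hq, Matrix.trace_mul_comm,
          hr, smul_eq_mul]
        push_cast [coe_two]
        ring
      · change (Q * ((P + (n : ℝ) • Q) * (P * Q - Q * P))).trace
          = ((-(r ^ 2 - 4 * p * q) : F) : ℝ)
        rw [← neg_sub, mul_neg, mul_neg, Matrix.trace_neg] at e4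
        rw [add_mul, mul_add, smul_mul_assoc, mul_smul_comm, Matrix.trace_add, Matrix.trace_smul,
          e2, neg_eq_iff_eq_neg.1 e4, hp, hq, Matrix.trace_mul_comm, hr, smul_zero]
        push_cast [coe_four]
        ring

include hP hQ hp hq hr in
/-- The algebra generated by two matrices of trace `0` over a field containing the traces of their
products is a quaternion algebra. -/
theorem exists_quaternion_adjoin (hD : r ^ 2 - 4 * p * q ≠ 0) :
    (∀ M ∈ Algebra.adjoin F {P, Q}, M.trace ∈ F) ∧ ∃ α : F, α ≠ 0 ∧
      (α = p ∨ ∃ s : F, r ^ 2 - 4 * p * q = s ^ 2) ∧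
      Nonempty (ℍ[F, α, 0, r ^ 2 - 4 * p * q] ≃ₐ[F] Algebra.adjoin F {P, Q}) := by
  -- If `p ≠ 0`, take `n = 0`. If `p = 0`, the second constant is `r²` with `r ≠ 0`, and `n²q + nr`
  -- cannot vanish at both `n = 1` and `n = -1`.
  obtain ⟨n, hα, hn⟩ : ∃ n : F, p + n ^ 2 * q + n * r ≠ 0 ∧
      (p + n ^ 2 * q + n * r = p ∨ ∃ s : F, r ^ 2 - 4 * p * q = s ^ 2) := by
    by_cases h0 : p = 0
    · have hr0 : r ≠ 0 := by
        rintro rfl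
        simp [h0] at hD
      have hs : ∃ s : F, r ^ 2 - 4 * p * q = s ^ 2 := ⟨r, by rw [h0]; ring⟩
      by_cases h1 : q + r = 0
      · refine ⟨-1, ?_, Or.inr hs⟩
        have : p + (-1) ^ 2 * q + -1 * r = -2 * r := by linear_combination h0 + h1
        rw [this]
        exact mul_ne_zero (by norm_num) hr0
      · exact ⟨1, by simpa [h0] using h1, Or.inr hs⟩
    · exact ⟨0, by simpa using h0, Or.inl (by ring)⟩
  have hR := pairBasis_range hP hQ hp hq hr n hα hD
  refine ⟨fun M hM => ?_, _, hα, hn,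
    ⟨(AlgEquiv.ofInjective _
      (quaternion_liftHom_injective (pairBasis hP hQ hp hq hr n) hα hD)).trans
      (Subalgebra.equivOfEq _ _ hR)⟩⟩
  rw [← hR] at hM
  obtain ⟨x, rfl⟩ := hM
  have := trace_quaternion (pairBasis hP hQ hp hq hr n) hα hD x
  change ((pairBasis hP hQ hp hq hr n).liftHom x).trace ∈ F
  rw [this]
  exact mul_mem (ofNat_mem F 2) x.re.2

end Traceless

end TriangleGroup

/-! ### Invariant trace field and algebra of a group generated by three reflections. -/

namespace TriangleGroup

section ReflectionGroup

open scoped Quaternion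

/-- The elements of determinant `1` of the group generated by three matrices and `-1`. -/
def reflectionGroup (A B C : GL (Fin 2) ℝ) : Subgroup SL(2, ℝ) :=
  (Subgroup.closure {-1, A, B, C}).comap Matrix.SpecialLinearGroup.toGL

/-- This allows the reflections to be relabelled cyclically, so that a vanishing trace can be placed
in the harmless position `z`. -/
lemma reflectionGroup_rotate (A B C : GL (Fin 2) ℝ) :
    reflectionGroup B C A = reflectionGroup A B C := by
  have h : ({-1, B, C, A} : Set (GL (Fin 2) ℝ)) = {-1, A, B, C} := by
    ext g
    simp only [Set.mem_insert_iff, Set.mem_singleton_iff]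
    tauto
  rw [reflectionGroup, h, reflectionGroup]

/-- The matrices with a multiple `c M` in a given algebra over `F`, where `c² ∈ F` and `c ≠ 0`. -/
def scaledSubmonoid {F : IntermediateField ℚ ℝ}
    (S : Subalgebra F (Matrix (Fin 2) (Fin 2) ℝ)) : Submonoid (Matrix (Fin 2) (Fin 2) ℝ) where
  carrier := {M | ∃ c : ℝ, c ≠ 0 ∧ c ^ 2 ∈ F ∧ c • M ∈ S}
  one_mem' := ⟨1, one_ne_zero, by simp, by simp⟩
  mul_mem' := by
    rintro M N ⟨c, hc, hcF, hcM⟩ ⟨d, hd, hdF, hdN⟩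
    refine ⟨c * d, mul_ne_zero hc hd, by rw [mul_pow]; exact mul_mem hcF hdF, ?_⟩
    have : (c * d) • (M * N) = (c • M) * (d • N) := by
      rw [smul_mul_assoc, mul_smul_comm, smul_smul]
    rw [this]
    exact mul_mem hcM hdN

/-- The unknown factor `c` may lie outside `F`, but squaring only involves `c² ∈ F`: `M² = c⁻²
(cM)²`. -/
lemma sq_mem_of_mem_scaledSubmonoid {F : IntermediateField ℚ ℝ}
    {S : Subalgebra F (Matrix (Fin 2) (Fin 2) ℝ)} {M : Matrix (Fin 2) (Fin 2) ℝ}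
    (hM : M ∈ scaledSubmonoid S) : M ^ 2 ∈ S := by
  obtain ⟨c, hc, hcF, hcM⟩ := hM
  have h : M ^ 2 = (⟨c ^ 2, hcF⟩⁻¹ : F) • (c • M) ^ 2 := by
    change _ = (c ^ 2)⁻¹ • (c • M) ^ 2
    rw [smul_pow, smul_smul, inv_mul_cancel₀ (pow_ne_zero 2 hc), one_smul]
  rw [h]
  exact Subalgebra.smul_mem _ (pow_mem hcM 2) _

lemma coe_inv_eq_trace_smul_sub (g : SL(2, ℝ)) :
    ((g⁻¹ : SL(2, ℝ)) : Matrix (Fin 2) (Fin 2) ℝ)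
      = (g : Matrix (Fin 2) (Fin 2) ℝ).trace • 1 - (g : Matrix (Fin 2) (Fin 2) ℝ) := by
  rw [Matrix.SpecialLinearGroup.coe_inv, Matrix.adjugate_fin_two]
  ext i j
  fin_cases i <;> fin_cases j <;> simp [Matrix.trace_fin_two]

/-- The group generated by `-1` and squares lies in an algebra with traces in `F` as soon as the
squares do. -/
lemma coe_mem_of_mem_squares {F : IntermediateField ℚ ℝ}
    {S : Subalgebra F (Matrix (Fin 2) (Fin 2) ℝ)} (htr : ∀ M ∈ S, M.trace ∈ F)
    {Δ : Subgroup SL(2, ℝ)} (h : ∀ δ ∈ Δ, (δ : Matrix (Fin 2) (Fin 2) ℝ) ^ 2 ∈ S)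
    {g : SL(2, ℝ)} (hg : g ∈ squares Δ) : (g : Matrix (Fin 2) (Fin 2) ℝ) ∈ S := by
  induction hg using Subgroup.closure_induction with
  | mem x hx =>
    rcases hx with rfl | ⟨δ, hδ, rfl⟩
    · rw [Matrix.SpecialLinearGroup.coe_neg, Matrix.SpecialLinearGroup.coe_one]
      exact neg_mem (one_mem S)
    · rw [Matrix.SpecialLinearGroup.coe_pow]
      exact h δ hδ
  | one =>
    rw [Matrix.SpecialLinearGroup.coe_one]
    exact one_mem S
  | mul x y _ _ hx hy =>
    rw [Matrix.SpecialLinearGroup.coe_mul]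
    exact mul_mem hx hy
  | inv x _ hx =>
    rw [coe_inv_eq_trace_smul_sub]
    exact sub_mem (Subalgebra.smul_mem _ (one_mem S) (⟨_, htr _ hx⟩ : F)) hx

lemma mul_self_eq_one_of_trace_eq_zero {M : Matrix (Fin 2) (Fin 2) ℝ} (h : M.trace = 0)
    (hd : M.det = -1) : M * M = 1 := by
  rw [mul_self_of_trace_eq_zero h]
  obtain ⟨a, b, c, rfl⟩ := exists_of_trace_eq_zero h
  rw [Matrix.det_fin_two_of] at hd
  have : (!![a, b; c, -a] * !![a, b; c, -a]).trace / 2 = 1 := by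
    simp [Matrix.trace_fin_two]
    linarith
  rw [this, one_smul]

/-- This is the Cayley–Hamilton relation for `BC`. It expresses the square of a rotation through `x
BC`, which is how `x BC` enters the invariant algebra. -/
lemma mul_mul_mul_of_mul_self {B C : Matrix (Fin 2) (Fin 2) ℝ} (hB : B * B = 1) (hC : C * C = 1)
    {x : ℝ} (h : B * C + C * B = x • 1) : (B * C) * (B * C) = x • (B * C) - 1 := by
  have h' : C * B = x • 1 - B * C := eq_sub_of_add_eq' h
  calc (B * C) * (B * C) = B * (C * B) * C := by simp only [mul_assoc]
    _ = x • (B * C) - (B * B) * (C * C) := by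
      rw [h', mul_sub, sub_mul, mul_smul_comm, smul_mul_assoc, mul_one]
      simp only [mul_assoc]
    _ = _ := by rw [hB, hC, one_mul]

/-- The elements of the group generated by three reflections lie in a submonoid containing the
products of two of them. -/
lemma coe_mem_of_mem_reflectionGroup {A B C : GL (Fin 2) ℝ}
    (hA : (A : Matrix (Fin 2) (Fin 2) ℝ) * A = 1) (hB : (B : Matrix (Fin 2) (Fin 2) ℝ) * B = 1)
    (hC : (C : Matrix (Fin 2) (Fin 2) ℝ) * C = 1)
    (dA : (A : Matrix (Fin 2) (Fin 2) ℝ).det = -1) (dB : (B : Matrix (Fin 2) (Fin 2) ℝ).det = -1)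
    (dC : (C : Matrix (Fin 2) (Fin 2) ℝ).det = -1)
    {S : Submonoid (Matrix (Fin 2) (Fin 2) ℝ)} (h1 : -1 ∈ S)
    (hAC : (A : Matrix (Fin 2) (Fin 2) ℝ) * C ∈ S) (hCA : (C : Matrix (Fin 2) (Fin 2) ℝ) * A ∈ S)
    (hBC : (B : Matrix (Fin 2) (Fin 2) ℝ) * C ∈ S) (hCB : (C : Matrix (Fin 2) (Fin 2) ℝ) * B ∈ S)
    {δ : SL(2, ℝ)} (hδ : δ ∈ reflectionGroup A B C) : (δ : Matrix (Fin 2) (Fin 2) ℝ) ∈ S := by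
  have hgen : ∀ g ∈ ({A, B, C} : Set (GL (Fin 2) ℝ)),
      (g : Matrix (Fin 2) (Fin 2) ℝ).det = -1 ∧ g⁻¹ = g ∧
      (g : Matrix (Fin 2) (Fin 2) ℝ) * C ∈ S ∧ (C : Matrix (Fin 2) (Fin 2) ℝ) * g ∈ S := by
    rintro g (rfl | rfl | rfl)
    · exact ⟨dA, inv_eq_of_mul_eq_one_left (Units.ext hA), hAC, hCA⟩
    · exact ⟨dB, inv_eq_of_mul_eq_one_left (Units.ext hB), hBC, hCB⟩
    · exact ⟨dC, inv_eq_of_mul_eq_one_left (Units.ext hC), by rw [hC]; exact one_mem S,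
        by rw [hC]; exact one_mem S⟩
  -- Invariant of the induction on words: an element of determinant `1` lies in `S`, and one of
  -- determinant `-1` does after left multiplication by `C`. Inserting `C² = 1` turns a product of
  -- reflections into products of pairs.
  have hstep : ∀ g ∈ ({-1, A, B, C} : Set (GL (Fin 2) ℝ)), ∀ y : GL (Fin 2) ℝ,
      ((y : Matrix (Fin 2) (Fin 2) ℝ).det = 1 ∧ (y : Matrix (Fin 2) (Fin 2) ℝ) ∈ S ∨
        (y : Matrix (Fin 2) (Fin 2) ℝ).det = -1 ∧ (C : Matrix (Fin 2) (Fin 2) ℝ) * y ∈ S) →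
      (((g * y : GL (Fin 2) ℝ) : Matrix (Fin 2) (Fin 2) ℝ).det = 1 ∧
        ((g * y : GL (Fin 2) ℝ) : Matrix (Fin 2) (Fin 2) ℝ) ∈ S ∨
        ((g * y : GL (Fin 2) ℝ) : Matrix (Fin 2) (Fin 2) ℝ).det = -1 ∧
        (C : Matrix (Fin 2) (Fin 2) ℝ) * ((g * y : GL (Fin 2) ℝ) : Matrix (Fin 2) (Fin 2) ℝ) ∈ S)
      := by
    intro g hg y hy
    rw [Units.val_mul, Matrix.det_mul]
    rcases hg with rfl | hg
    · have hd : ((-1 : GL (Fin 2) ℝ) : Matrix (Fin 2) (Fin 2) ℝ).det = 1 := by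
        rw [Units.val_neg, Units.val_one, Matrix.det_neg]
        simp
      rw [hd, one_mul, Units.val_neg, Units.val_one]
      rcases hy with ⟨h, h'⟩ | ⟨h, h'⟩
      · exact Or.inl ⟨h, mul_mem h1 h'⟩
      · refine Or.inr ⟨h, ?_⟩
        rw [neg_one_mul, mul_neg, ← neg_one_mul]
        exact mul_mem h1 h'
    · obtain ⟨hd, -, hgC, hCg⟩ := hgen g hg
      rcases hy with ⟨h, h'⟩ | ⟨h, h'⟩
      · refine Or.inr ⟨by rw [hd, h]; norm_num, ?_⟩
        rw [← mul_assoc]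
        exact mul_mem hCg h'
      · refine Or.inl ⟨by rw [hd, h]; norm_num, ?_⟩
        have : (g : Matrix (Fin 2) (Fin 2) ℝ) * y = (g * C) * (C * y) := by
          rw [mul_assoc, ← mul_assoc (C : Matrix (Fin 2) (Fin 2) ℝ), hC, one_mul]
        rw [this]
        exact mul_mem hgC h'
  have hinv : ∀ g ∈ ({-1, A, B, C} : Set (GL (Fin 2) ℝ)), g⁻¹ = g := by
    rintro g (rfl | hg)
    · exact inv_neg_one
    · exact (hgen g hg).2.1
  have key : ∀ y ∈ Subgroup.closure ({-1, A, B, C} : Set (GL (Fin 2) ℝ)),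
      ((y : Matrix (Fin 2) (Fin 2) ℝ).det = 1 ∧ (y : Matrix (Fin 2) (Fin 2) ℝ) ∈ S ∨
        (y : Matrix (Fin 2) (Fin 2) ℝ).det = -1 ∧ (C : Matrix (Fin 2) (Fin 2) ℝ) * y ∈ S) := by
    intro y hy
    induction hy using Subgroup.closure_induction_left with
    | one => exact Or.inl ⟨by simp, by rw [Units.val_one]; exact one_mem S⟩
    | mul_left g hg y _ ih => exact hstep g hg y ih
    | inv_mul_cancel g hg y _ ih => rw [hinv g hg]; exact hstep g hg y ih
  have hδd : (δ : Matrix (Fin 2) (Fin 2) ℝ).det = 1 := δ.det_coe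
  rcases key _ hδ with ⟨-, h⟩ | ⟨h, -⟩
  · exact h
  · change (δ : Matrix (Fin 2) (Fin 2) ℝ).det = -1 at h
    linarith

variable {A B C : GL (Fin 2) ℝ}

lemma exists_mem_reflectionGroup {g h : GL (Fin 2) ℝ}
    (hg : g ∈ ({-1, A, B, C} : Set (GL (Fin 2) ℝ)))
    (hh : h ∈ ({-1, A, B, C} : Set (GL (Fin 2) ℝ)))
    (dg : (g : Matrix (Fin 2) (Fin 2) ℝ).det = -1) (dh : (h : Matrix (Fin 2) (Fin 2) ℝ).det = -1) :
    ∃ δ ∈ reflectionGroup A B C,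
      (δ : Matrix (Fin 2) (Fin 2) ℝ) = (g : Matrix (Fin 2) (Fin 2) ℝ) * h := by
  let δ : SL(2, ℝ) := ⟨(g : Matrix (Fin 2) (Fin 2) ℝ) * h, by rw [Matrix.det_mul, dg, dh]; norm_num⟩
  have hδ : Matrix.SpecialLinearGroup.toGL δ = g * h := Units.ext rfl
  refine ⟨δ, ?_, rfl⟩
  change Matrix.SpecialLinearGroup.toGL δ ∈ Subgroup.closure {-1, A, B, C}
  rw [hδ]
  exact mul_mem (Subgroup.subset_closure hg) (Subgroup.subset_closure hh)

lemma trace_mem_invariantTraceField {Δ : Subgroup SL(2, ℝ)} {g : SL(2, ℝ)} (hg : g ∈ squares Δ) :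
    (g : Matrix (Fin 2) (Fin 2) ℝ).trace ∈ invariantTraceField Δ :=
  IntermediateField.subset_adjoin _ _ ⟨g, hg, rfl⟩

lemma sq_mem_squares {Δ : Subgroup SL(2, ℝ)} {δ : SL(2, ℝ)} (hδ : δ ∈ Δ) : δ ^ 2 ∈ squares Δ :=
  Subgroup.subset_closure (Or.inr ⟨δ, hδ, rfl⟩)

/-- The invariant trace field and the invariant quaternion algebra of the group generated by three
reflections, in terms of the traces `x, y, z` of the products of two of them. -/
theorem reflectionGroup_invariants
    (tA : (A : Matrix (Fin 2) (Fin 2) ℝ).trace = 0) (tB : (B : Matrix (Fin 2) (Fin 2) ℝ).trace = 0)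
    (tC : (C : Matrix (Fin 2) (Fin 2) ℝ).trace = 0)
    (dA : (A : Matrix (Fin 2) (Fin 2) ℝ).det = -1) (dB : (B : Matrix (Fin 2) (Fin 2) ℝ).det = -1)
    (dC : (C : Matrix (Fin 2) (Fin 2) ℝ).det = -1) {x y z : ℝ}
    (hx : ((B : Matrix (Fin 2) (Fin 2) ℝ) * C).trace = x)
    (hy : ((C : Matrix (Fin 2) (Fin 2) ℝ) * A).trace = y)
    (hz : ((A : Matrix (Fin 2) (Fin 2) ℝ) * B).trace = z) (hx0 : x ≠ 0) (hy0 : y ≠ 0)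
    (hβ : x ^ 2 + y ^ 2 + z ^ 2 - x * y * z - 4 ≠ 0) :
    invariantTraceField (reflectionGroup A B C)
        = IntermediateField.adjoin ℚ {x ^ 2, y ^ 2, z ^ 2, x * y * z} ∧
      ∃ α D : invariantTraceField (reflectionGroup A B C), α ≠ 0 ∧
        (D : ℝ) = 16 * x ^ 2 * y ^ 2 * (x ^ 2 + y ^ 2 + z ^ 2 - x * y * z - 4) ∧
        ((α : ℝ) = x ^ 2 * (x ^ 2 - 4) ∨ ∃ s, D = s ^ 2) ∧
        Nonempty (ℍ[invariantTraceField (reflectionGroup A B C), α, 0, D]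
          ≃ₐ[invariantTraceField (reflectionGroup A B C)]
            invariantAlgebra (reflectionGroup A B C)) := by
  have hA := mul_self_eq_one_of_trace_eq_zero tA dA
  have hB := mul_self_eq_one_of_trace_eq_zero tB dB
  have hC := mul_self_eq_one_of_trace_eq_zero tC dC
  have hBC := mul_add_mul_of_trace_eq_zero tB tC
  have hCA := mul_add_mul_of_trace_eq_zero tC tA
  have hAB := mul_add_mul_of_trace_eq_zero tA tB
  have hBA : ((B : Matrix (Fin 2) (Fin 2) ℝ) * A).trace = z := by rw [Matrix.trace_mul_comm, hz]
  rw [hx] at hBC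
  rw [hy] at hCA
  rw [hz] at hAB
  have sBC := mul_mul_mul_of_mul_self hB hC hBC
  have sCA := mul_mul_mul_of_mul_self hC hA hCA
  have sAB := mul_mul_mul_of_mul_self hA hB hAB
  obtain ⟨δ₁, hδ₁, e₁⟩ := exists_mem_reflectionGroup (A := A) (B := B) (C := C) (g := B) (h := C)
    (by simp) (by simp) dB dC
  obtain ⟨δ₂, hδ₂, e₂⟩ := exists_mem_reflectionGroup (A := A) (B := B) (C := C) (g := C) (h := A)
    (by simp) (by simp) dC dA
  obtain ⟨δ₃, hδ₃, e₃⟩ := exists_mem_reflectionGroup (A := A) (B := B) (C := C) (g := A) (h := B)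
    (by simp) (by simp) dA dB
  have f₁ : ((δ₁ ^ 2 : SL(2, ℝ)) : Matrix (Fin 2) (Fin 2) ℝ)
      = x • ((B : Matrix (Fin 2) (Fin 2) ℝ) * C) - 1 := by
    rw [Matrix.SpecialLinearGroup.coe_pow, e₁, pow_two, sBC]
  have f₂ : ((δ₂ ^ 2 : SL(2, ℝ)) : Matrix (Fin 2) (Fin 2) ℝ)
      = y • ((C : Matrix (Fin 2) (Fin 2) ℝ) * A) - 1 := by
    rw [Matrix.SpecialLinearGroup.coe_pow, e₂, pow_two, sCA]
  have f₃ : ((δ₃ ^ 2 : SL(2, ℝ)) : Matrix (Fin 2) (Fin 2) ℝ)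
      = z • ((A : Matrix (Fin 2) (Fin 2) ℝ) * B) - 1 := by
    rw [Matrix.SpecialLinearGroup.coe_pow, e₃, pow_two, sAB]
  have g₁ := sq_mem_squares hδ₁
  have g₂ := sq_mem_squares hδ₂
  have g₃ := sq_mem_squares hδ₃
  set Γ := reflectionGroup A B C with hΓ
  have hxE : x ^ 2 ∈ invariantTraceField Γ := by
    have h := trace_mem_invariantTraceField g₁
    rw [f₁, Matrix.trace_sub, Matrix.trace_smul, hx, Matrix.trace_one] at h
    simpa [pow_two] using add_mem h (ofNat_mem (invariantTraceField Γ) 2)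
  have hyE : y ^ 2 ∈ invariantTraceField Γ := by
    have h := trace_mem_invariantTraceField g₂
    rw [f₂, Matrix.trace_sub, Matrix.trace_smul, hy, Matrix.trace_one] at h
    simpa [pow_two] using add_mem h (ofNat_mem (invariantTraceField Γ) 2)
  have hzE : z ^ 2 ∈ invariantTraceField Γ := by
    have h := trace_mem_invariantTraceField g₃
    rw [f₃, Matrix.trace_sub, Matrix.trace_smul, hz, Matrix.trace_one] at h
    simpa [pow_two] using add_mem h (ofNat_mem (invariantTraceField Γ) 2)
  have hxyzE : x * y * z ∈ invariantTraceField Γ := by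
    have h := trace_mem_invariantTraceField (mul_mem g₁ g₂)
    -- In the product of the squares of `BC` and `CA` the inner `C²` cancels, so its trace is `xyz -
    -- x² - y² + 2`.
    have e : (x • ((B : Matrix (Fin 2) (Fin 2) ℝ) * C) - 1)
          * (y • ((C : Matrix (Fin 2) (Fin 2) ℝ) * A) - 1)
        = (x * y) • ((B : Matrix (Fin 2) (Fin 2) ℝ) * (C * C) * A)
          - x • ((B : Matrix (Fin 2) (Fin 2) ℝ) * C)
          - y • ((C : Matrix (Fin 2) (Fin 2) ℝ) * A) + 1 := by
      rw [sub_mul, mul_sub, smul_mul_smul_comm, mul_one, one_mul]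
      simp only [mul_assoc]
      abel
    rw [Matrix.SpecialLinearGroup.coe_mul, f₁, f₂, e, hC, mul_one, Matrix.trace_add,
      Matrix.trace_sub, Matrix.trace_sub, Matrix.trace_smul, Matrix.trace_smul, Matrix.trace_smul,
      hx, hy, hBA, Matrix.trace_one] at h
    have h' := sub_mem (add_mem (add_mem h hxE) hyE) (ofNat_mem (invariantTraceField Γ) 2)
    convert h' using 1
    simp
    ring
  set P : Matrix (Fin 2) (Fin 2) ℝ := x • ((B : Matrix (Fin 2) (Fin 2) ℝ) * C - C * B) with hPdef
  set Q : Matrix (Fin 2) (Fin 2) ℝ := y • ((C : Matrix (Fin 2) (Fin 2) ℝ) * A - A * C) with hQdef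
  have tP : P.trace = 0 := by
    rw [hPdef, Matrix.trace_smul, Matrix.trace_sub, Matrix.trace_mul_comm, sub_self, smul_zero]
  have tQ : Q.trace = 0 := by
    rw [hQdef, Matrix.trace_smul, Matrix.trace_sub, Matrix.trace_mul_comm, sub_self, smul_zero]
  have tAA : ((A : Matrix (Fin 2) (Fin 2) ℝ) * A).trace = 2 := by rw [hA]; simp
  have tBB : ((B : Matrix (Fin 2) (Fin 2) ℝ) * B).trace = 2 := by rw [hB]; simp
  have tCC : ((C : Matrix (Fin 2) (Fin 2) ℝ) * C).trace = 2 := by rw [hC]; simp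
  have tPP : (P * P).trace = 2 * (x ^ 2 * (x ^ 2 - 4)) := by
    rw [hPdef, smul_mul_smul_comm, commutator_mul_self tB tC, hx, tBB, tCC, Matrix.trace_smul,
      Matrix.trace_smul, Matrix.trace_one]
    simp
    ring
  have tQQ : (Q * Q).trace = 2 * (y ^ 2 * (y ^ 2 - 4)) := by
    rw [hQdef, smul_mul_smul_comm, commutator_mul_self tC tA, hy, tCC, tAA, Matrix.trace_smul,
      Matrix.trace_smul, Matrix.trace_one]
    simp
    ring
  have tPQ : (P * Q).trace = 4 * (x * y * z) - 2 * x ^ 2 * y ^ 2 := by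
    rw [hPdef, hQdef, smul_mul_smul_comm, Matrix.trace_smul,
      trace_commutator_mul_commutator tA tB tC, hx, hy, hz, tCC, smul_eq_mul]
    ring
  have Px : P = (2 * x) • ((B : Matrix (Fin 2) (Fin 2) ℝ) * C) - x ^ 2 • 1 := by
    rw [hPdef, eq_sub_of_add_eq' hBC]
    module
  have Qx : Q = (2 * y) • ((C : Matrix (Fin 2) (Fin 2) ℝ) * A) - y ^ 2 • 1 := by
    rw [hQdef, eq_sub_of_add_eq' hCA]
    module
  -- The field is kept general because the claim is used twice: over `ℚ(x², y², z², xyz)` to bound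
  -- `E` from above, then over `E` itself to identify the invariant algebra.
  have main : ∀ F : IntermediateField ℚ ℝ, x ^ 2 ∈ F → y ^ 2 ∈ F → x * y * z ∈ F →
      (z ^ 2 ∈ F) →
      (∀ M ∈ Algebra.adjoin F {P, Q}, M.trace ∈ F) ∧
      (∀ g ∈ squares Γ, (g : Matrix (Fin 2) (Fin 2) ℝ) ∈ Algebra.adjoin F {P, Q}) ∧
      ∃ α D : F, α ≠ 0 ∧
        (D : ℝ) = 16 * x ^ 2 * y ^ 2 * (x ^ 2 + y ^ 2 + z ^ 2 - x * y * z - 4) ∧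
        ((α : ℝ) = x ^ 2 * (x ^ 2 - 4) ∨ ∃ s, D = s ^ 2) ∧
        Nonempty (ℍ[F, α, 0, D] ≃ₐ[F] Algebra.adjoin F {P, Q}) := by
    intro F hxF hyF hxyzF hzF
    let X : F := ⟨x ^ 2, hxF⟩
    let Y : F := ⟨y ^ 2, hyF⟩
    let W : F := ⟨x * y * z, hxyzF⟩
    let p : F := X * (X - 4)
    let q : F := Y * (Y - 4)
    let r : F := 4 * W - 2 * X * Y
    have hD : ((r ^ 2 - 4 * p * q : F) : ℝ)
        = 16 * x ^ 2 * y ^ 2 * (x ^ 2 + y ^ 2 + z ^ 2 - x * y * z - 4) := by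
      change (4 * (x * y * z) - 2 * x ^ 2 * y ^ 2) ^ 2
        - 4 * (x ^ 2 * (x ^ 2 - 4)) * (y ^ 2 * (y ^ 2 - 4)) = _
      ring
    have hD0 : r ^ 2 - 4 * p * q ≠ 0 := by
      intro h
      rw [h] at hD
      exact mul_ne_zero (mul_ne_zero (mul_ne_zero (by norm_num) (pow_ne_zero 2 hx0))
        (pow_ne_zero 2 hy0)) hβ hD.symm
    obtain ⟨htr, α, hα, hα', hiso⟩ := exists_quaternion_adjoin (F := F) (p := p) (q := q) (r := r)
      tP tQ tPP tQQ tPQ hD0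
    have hPm : P ∈ Algebra.adjoin F {P, Q} := Algebra.subset_adjoin (by simp)
    have hQm : Q ∈ Algebra.adjoin F {P, Q} := Algebra.subset_adjoin (by simp)
    have hone : ∀ a ∈ F, a • (1 : Matrix (Fin 2) (Fin 2) ℝ) ∈ Algebra.adjoin F {P, Q} :=
      fun a ha => Subalgebra.smul_mem _ (one_mem _) (⟨a, ha⟩ : F)
    have hhalf : ∀ M ∈ Algebra.adjoin F {P, Q}, (1 / 2 : ℝ) • M ∈ Algebra.adjoin F {P, Q} :=
      fun M hM => Subalgebra.smul_mem _ hM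
        (⟨1 / 2, div_mem (one_mem F) (ofNat_mem F 2)⟩ : F)
    have m₁ : x • ((B : Matrix (Fin 2) (Fin 2) ℝ) * C) ∈ Algebra.adjoin F {P, Q} := by
      have : x • ((B : Matrix (Fin 2) (Fin 2) ℝ) * C) = (1 / 2 : ℝ) • (P + x ^ 2 • 1) := by
        rw [Px]
        module
      rw [this]
      exact hhalf _ (add_mem hPm (hone _ hxF))
    have m₂ : x • ((C : Matrix (Fin 2) (Fin 2) ℝ) * B) ∈ Algebra.adjoin F {P, Q} := by
      have : x • ((C : Matrix (Fin 2) (Fin 2) ℝ) * B)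
          = x ^ 2 • 1 - x • ((B : Matrix (Fin 2) (Fin 2) ℝ) * C) := by
        rw [eq_sub_of_add_eq' hBC]
        module
      rw [this]
      exact sub_mem (hone _ hxF) m₁
    have m₃ : y • ((C : Matrix (Fin 2) (Fin 2) ℝ) * A) ∈ Algebra.adjoin F {P, Q} := by
      have : y • ((C : Matrix (Fin 2) (Fin 2) ℝ) * A) = (1 / 2 : ℝ) • (Q + y ^ 2 • 1) := by
        rw [Qx]
        module
      rw [this]
      exact hhalf _ (add_mem hQm (hone _ hyF))
    have m₄ : y • ((A : Matrix (Fin 2) (Fin 2) ℝ) * C) ∈ Algebra.adjoin F {P, Q} := by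
      have : y • ((A : Matrix (Fin 2) (Fin 2) ℝ) * C)
          = y ^ 2 • 1 - y • ((C : Matrix (Fin 2) (Fin 2) ℝ) * A) := by
        rw [eq_sub_of_add_eq' hCA]
        module
      rw [this]
      exact sub_mem (hone _ hyF) m₃
    refine ⟨htr, fun g hg => coe_mem_of_mem_squares htr (fun δ hδ => ?_) hg, α, _, hα, hD, ?_, hiso⟩
    -- The scaling factors are `y` for the products of `A` and `C`, and `x` for those of `B` and
    -- `C`; this is where `x, y ≠ 0` is needed.
    · refine sq_mem_of_mem_scaledSubmonoid
        (coe_mem_of_mem_reflectionGroup hA hB hC dA dB dC ?_ ?_ ?_ ?_ ?_ hδ)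
      · exact ⟨1, one_ne_zero, by simp, by rw [one_smul]; exact neg_mem (one_mem _)⟩
      · exact ⟨y, hy0, hyF, m₄⟩
      · exact ⟨y, hy0, hyF, m₃⟩
      · exact ⟨x, hx0, hxF, m₁⟩
      · exact ⟨x, hx0, hxF, m₂⟩
    · rcases hα' with h | h
      · exact Or.inl (congrArg Subtype.val h)
      · exact Or.inr h
  constructor
  · apply le_antisymm
    · set F := IntermediateField.adjoin ℚ {x ^ 2, y ^ 2, z ^ 2, x * y * z} with hF
      obtain ⟨htr, hsq, -⟩ := main F (IntermediateField.subset_adjoin _ _ (by simp))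
        (IntermediateField.subset_adjoin _ _ (by simp))
        (IntermediateField.subset_adjoin _ _ (by simp))
        (IntermediateField.subset_adjoin _ _ (by simp))
      rw [invariantTraceField, IntermediateField.adjoin_le_iff]
      rintro _ ⟨g, hg, rfl⟩
      exact htr _ (hsq g hg)
    · rw [IntermediateField.adjoin_le_iff]
      rintro _ (rfl | rfl | rfl | rfl)
      · exact hxE
      · exact hyE
      · exact hzE
      · exact hxyzE
  · obtain ⟨-, hsq, α, D, hα, hD, hα', ⟨e⟩⟩ := main _ hxE hyE hxyzE hzE
    have hAeq : Algebra.adjoin (invariantTraceField Γ) {P, Q} = invariantAlgebra Γ := by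
      apply le_antisymm
      · have hcoe : ∀ g ∈ squares Γ, (g : Matrix (Fin 2) (Fin 2) ℝ) ∈ invariantAlgebra Γ :=
          fun g hg => Algebra.subset_adjoin ⟨g, hg, rfl⟩
        have hone : ∀ a ∈ invariantTraceField Γ,
            a • (1 : Matrix (Fin 2) (Fin 2) ℝ) ∈ invariantAlgebra Γ :=
          fun a ha => Subalgebra.smul_mem _ (one_mem _) (⟨a, ha⟩ : invariantTraceField Γ)
        have htwo := ofNat_mem (invariantTraceField Γ) 2
        rw [Algebra.adjoin_le_iff]
        refine Set.insert_subset ?_ (Set.singleton_subset_iff.2 ?_)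
        · have h1 := hcoe _ g₁
          have : P = ((δ₁ ^ 2 : SL(2, ℝ)) : Matrix (Fin 2) (Fin 2) ℝ)
              + ((δ₁ ^ 2 : SL(2, ℝ)) : Matrix (Fin 2) (Fin 2) ℝ) + (2 - x ^ 2) • 1 := by
            rw [f₁, Px]
            module
          rw [SetLike.mem_coe, this]
          exact add_mem (add_mem h1 h1) (hone _ (sub_mem htwo hxE))
        · have h1 := hcoe _ g₂
          have : Q = ((δ₂ ^ 2 : SL(2, ℝ)) : Matrix (Fin 2) (Fin 2) ℝ)
              + ((δ₂ ^ 2 : SL(2, ℝ)) : Matrix (Fin 2) (Fin 2) ℝ) + (2 - y ^ 2) • 1 := by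
            rw [f₂, Qx]
            module
          rw [SetLike.mem_coe, this]
          exact add_mem (add_mem h1 h1) (hone _ (sub_mem htwo hyE))
      · rw [invariantAlgebra, Algebra.adjoin_le_iff]
        rintro _ ⟨g, hg, rfl⟩
        exact hsq g hg
    exact ⟨α, D, hα, hD, hα', ⟨e.trans (Subalgebra.equivOfEq _ _ hAeq)⟩⟩

end ReflectionGroup

end TriangleGroup

/-! ### Positivity of `β` and the Galois action on cosines. -/

namespace TriangleGroup

open NumberField

lemma lam_two_mul (s : ℕ∞) : lam (2 * s) = 2 * Real.cos (Real.pi * recip s) := by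
  rw [lam, ← recip_two_mul s]
  ring_nf

lemma lam_eq_sq_sub_two (s : ℕ∞) : lam s = lam (2 * s) ^ 2 - 2 := by
  rw [lam_two_mul, lam, mul_assoc, Real.cos_two_mul]
  ring

namespace HyperbolicTriple

variable (t : HyperbolicTriple)

lemma beta_eq : t.beta = lam (2 * t.a) ^ 2 + lam (2 * t.b) ^ 2 + lam (2 * t.c) ^ 2
    + lam (2 * t.a) * lam (2 * t.b) * lam (2 * t.c) - 4 := by
  rw [beta, lam_eq_sq_sub_two t.a, lam_eq_sq_sub_two t.b, lam_eq_sq_sub_two t.c]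
  ring

/-- With `A, B, C` the angles, `β = 4 (cos A + cos(B + C)) (cos A + cos(B - C))`. The first factor
is positive because `A < π - (B + C)`, and the second is at least as large because `sin B sin C ≥
0`. -/
lemma beta_pos : 0 < t.beta := by
  have hpi := Real.pi_pos
  have bd : ∀ s : ℕ∞, 2 ≤ s → 0 ≤ Real.pi * recip s ∧ Real.pi * recip s ≤ Real.pi / 2 :=
    fun s hs => ⟨mul_nonneg hpi.le (recip_nonneg s), by nlinarith [recip_le hs]⟩
  obtain ⟨a0, a1⟩ := bd _ t.two_le_a
  obtain ⟨b0, b1⟩ := bd _ t.two_le_b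
  obtain ⟨c0, c1⟩ := bd _ t.two_le_c
  have hsum : Real.pi * recip t.a + Real.pi * recip t.b + Real.pi * recip t.c < Real.pi := by
    nlinarith [t.chi_neg]
  rw [beta_eq, lam_two_mul, lam_two_mul, lam_two_mul]
  generalize Real.pi * recip t.a = A at *
  generalize Real.pi * recip t.b = B at *
  generalize Real.pi * recip t.c = C at *
  have e1 : 0 < Real.cos A + Real.cos (B + C) := by
    have := Real.cos_lt_cos_of_nonneg_of_le_pi (x := A) (y := Real.pi - (B + C)) a0
      (by linarith) (by linarith)
    rw [Real.cos_pi_sub] at this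
    linarith
  have e2 : 0 ≤ Real.sin B * Real.sin C :=
    mul_nonneg (Real.sin_nonneg_of_nonneg_of_le_pi b0 (by linarith))
      (Real.sin_nonneg_of_nonneg_of_le_pi c0 (by linarith))
  rw [Real.cos_add] at e1
  have e3 : 0 < Real.cos A + (Real.cos B * Real.cos C + Real.sin B * Real.sin C) := by linarith
  have sB := Real.sin_sq_add_cos_sq B
  have sC := Real.sin_sq_add_cos_sq C
  have : (2 * Real.cos A) ^ 2 + (2 * Real.cos B) ^ 2 + (2 * Real.cos C) ^ 2
      + 2 * Real.cos A * (2 * Real.cos B) * (2 * Real.cos C) - 4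
      = 4 * ((Real.cos A + (Real.cos B * Real.cos C - Real.sin B * Real.sin C))
        * (Real.cos A + (Real.cos B * Real.cos C + Real.sin B * Real.sin C))) := by
    linear_combination 4 * (1 - Real.cos C ^ 2) * sB + 4 * Real.sin B ^ 2 * sC
  rw [this]
  exact mul_pos (by norm_num) (mul_pos e1 e3)

/-- The set `{a, b, c}`. -/
def indices : Set ℕ∞ := {t.a, t.b, t.c}

lemma a_mem : t.a ∈ t.indices := by simp [indices]

lemma b_mem : t.b ∈ t.indices := by simp [indices]

lemma c_mem : t.c ∈ t.indices := by simp [indices]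

variable {t}

lemma zeta_mem {s : ℕ∞} (hs : s ∈ t.indices) : zeta (2 * s) ∈ t.K := by
  apply IntermediateField.subset_adjoin ℚ
  rcases hs with rfl | rfl | rfl <;> simp

lemma two_le_of_mem {s : ℕ∞} (hs : s ∈ t.indices) : 2 ≤ s := by
  rcases hs with rfl | rfl | rfl
  exacts [t.two_le_a, t.two_le_b, t.two_le_c]

lemma finPart_dvd_of_mem {s : ℕ∞} (hs : s ∈ t.indices) : finPart s ∣ t.m := by
  rcases hs with rfl | rfl | rfl
  exacts [(Nat.dvd_lcm_left _ _).trans (Nat.dvd_lcm_left _ _),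
    (Nat.dvd_lcm_right _ _).trans (Nat.dvd_lcm_left _ _), Nat.dvd_lcm_right _ _]

lemma exists_zeta2m_pow {s : ℕ∞} (hs : s ∈ t.indices) : ∃ i, t.zeta2m ^ i = zeta (2 * s) := by
  have hs2 := two_le_of_mem hs
  have hd := finPart_dvd_of_mem hs
  cases s with
  | top =>
    refine ⟨0, ?_⟩
    have h : (2 : ℕ∞) * ⊤ = ⊤ := by simp
    rw [h, zeta_top, pow_zero]
  | coe n =>
    have h2 : (2 : ℕ∞) * (n : ℕ∞) = ((2 * n : ℕ) : ℕ∞) := by push_cast; rfl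
    have hn : 2 ≤ n := by exact_mod_cast hs2
    have hp : IsPrimitiveRoot (zeta (2 * (n : ℕ∞))) (2 * n) := by
      rw [h2, zeta_coe]
      exact Complex.isPrimitiveRoot_exp _ (by omega)
    obtain ⟨i, -, hi⟩ := t.isPrimitiveRoot_zeta2m.eq_pow_of_pow_eq_one
      ((hp.pow_eq_one_iff_dvd _).2 (Nat.mul_dvd_mul_left 2 hd))
    exact ⟨i, hi⟩

lemma sigma_zeta (k : (ZMod (2 * t.m))ˣ) {s : ℕ∞} (hs : s ∈ t.indices) :
    t.sigma k ⟨zeta (2 * s), zeta_mem hs⟩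
      = ⟨zeta (2 * s), zeta_mem hs⟩ ^ (k : ZMod (2 * t.m)).val := by
  obtain ⟨i, hi⟩ := exists_zeta2m_pow hs
  have h : (⟨zeta (2 * s), zeta_mem hs⟩ : t.K) = ⟨t.zeta2m, t.zeta2m_mem⟩ ^ i :=
    Subtype.ext hi.symm
  rw [h, map_pow, sigma_zeta2m, pow_right_comm]

lemma lam_mem {s : ℕ∞} (hs : s ∈ t.indices) : (lam (2 * s) : ℂ) ∈ t.K := by
  rw [lam_eq]
  exact add_mem (zeta_mem hs) (inv_mem (zeta_mem hs))

/-- `λ_{2s}` as an element of `K`. -/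
noncomputable def lamK {s : ℕ∞} (hs : s ∈ t.indices) : t.K := ⟨lam (2 * s), lam_mem hs⟩

/-- `σ_k` raises `ζ_{2s}`, a power of `ζ_{2m}`, to the power `k`, and `λ_{2s} = ζ_{2s} + ζ_{2s}⁻¹`.
-/
lemma sigma_lam (k : (ZMod (2 * t.m))ˣ) {s : ℕ∞} (hs : s ∈ t.indices) :
    (t.sigma k (lamK hs) : ℂ) = ((2 * t.cosK k s : ℝ) : ℂ) := by
  have h : lamK hs = (⟨zeta (2 * s), zeta_mem hs⟩ : t.K) + (⟨zeta (2 * s), zeta_mem hs⟩ : t.K)⁻¹ :=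
    Subtype.ext (lam_eq (2 * s))
  rw [h, map_add, map_inv₀, sigma_zeta k hs]
  change zeta (2 * s) ^ (k : ZMod (2 * t.m)).val + (zeta (2 * s) ^ (k : ZMod (2 * t.m)).val)⁻¹ = _
  rw [zeta, ← Complex.exp_nat_mul, ← Complex.exp_neg, cosK, ← recip_two_mul s]
  push_cast
  rw [Complex.two_cos]
  congr 2 <;> ring

variable (t)

/-- `β` is an integral polynomial in the three `λ_{2s}`, so it suffices to replace each by `2
cos(kπ/s)`. This identity links the two sign conditions. -/
lemma sigmaBeta_eq (k : (ZMod (2 * t.m))ˣ) : t.sigmaBeta k = ((-4 * t.kappa k : ℝ) : ℂ) := by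
  have h : (⟨(t.beta : ℂ), t.beta_mem⟩ : t.K) = lamK t.a_mem ^ 2 + lamK t.b_mem ^ 2
      + lamK t.c_mem ^ 2 + lamK t.a_mem * lamK t.b_mem * lamK t.c_mem - 4 := by
    apply Subtype.ext
    change (t.beta : ℂ) = (lam (2 * t.a) : ℂ) ^ 2 + (lam (2 * t.b) : ℂ) ^ 2
      + (lam (2 * t.c) : ℂ) ^ 2 + lam (2 * t.a) * lam (2 * t.b) * lam (2 * t.c) - 4
    rw [beta_eq]
    push_cast
    ring
  rw [sigmaBeta, h]
  simp only [map_add, map_sub, map_mul, map_pow, map_ofNat]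
  change (t.sigma k (lamK t.a_mem) : ℂ) ^ 2 + (t.sigma k (lamK t.b_mem) : ℂ) ^ 2
    + (t.sigma k (lamK t.c_mem) : ℂ) ^ 2
    + (t.sigma k (lamK t.a_mem) : ℂ) * (t.sigma k (lamK t.b_mem) : ℂ)
      * (t.sigma k (lamK t.c_mem) : ℂ) - 4 = _
  rw [sigma_lam, sigma_lam, sigma_lam, kappa]
  push_cast
  ring

lemma sigmaBeta_pos_iff (k : (ZMod (2 * t.m))ˣ) : 0 < t.sigmaBeta k ↔ t.kappa k < 0 := by
  rw [sigmaBeta_eq, Complex.zero_lt_real]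
  constructor <;> intro h <;> linarith

end HyperbolicTriple

/-! ### The triangle group: its invariants, and the places of its trace field. -/

namespace Triangle

open HyperbolicTriple
open scoped Quaternion

variable {t : HyperbolicTriple} (T : Triangle t)

lemma trace_nb_mul_nc :
    ((T.nb : Matrix (Fin 2) (Fin 2) ℝ) * T.nc).trace = -lam (2 * t.a) := by
  have h := T.angle_a
  rw [Units.val_mul] at h
  rw [lam_two_mul]
  linarith

lemma trace_nc_mul_na :
    ((T.nc : Matrix (Fin 2) (Fin 2) ℝ) * T.na).trace = -lam (2 * t.b) := by
  have h := T.angle_b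
  rw [Units.val_mul] at h
  rw [lam_two_mul]
  linarith

lemma trace_na_mul_nb :
    ((T.na : Matrix (Fin 2) (Fin 2) ℝ) * T.nb).trace = -lam (2 * t.c) := by
  have h := T.angle_c
  rw [Units.val_mul] at h
  rw [lam_two_mul]
  linarith

/-- The invariant trace field and the invariant quaternion algebra of a triangle group. -/
theorem group_invariants :
    invariantTraceField T.group = IntermediateField.adjoin ℚ {lam (2 * t.a) ^ 2,
      lam (2 * t.b) ^ 2, lam (2 * t.c) ^ 2, -(lam (2 * t.a) * lam (2 * t.b) * lam (2 * t.c))} ∧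
    ∃ u ∈ t.indices, ∃ w ∈ t.indices, ∃ α D : invariantTraceField T.group, α ≠ 0 ∧ D ≠ 0 ∧
      (D : ℝ) = 16 * lam (2 * u) ^ 2 * lam (2 * w) ^ 2 * t.beta ∧
      ((α : ℝ) = lam (2 * u) ^ 2 * (lam (2 * u) ^ 2 - 4) ∨ ∃ s, D = s ^ 2) ∧
      Nonempty (ℍ[invariantTraceField T.group, α, 0, D] ≃ₐ[invariantTraceField T.group]
        invariantAlgebra T.group) := by
  have hβ := t.beta_pos
  have hβeq := t.beta_eq
  have hle : ∀ s, lam (2 * s) ^ 2 ≤ 4 := fun s => by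
    rw [lam_two_mul]
    nlinarith [Real.cos_sq_le_one (Real.pi * recip s)]
  -- If two of the `λ_{2s}` vanished, `β` would reduce to `λ² - 4 ≤ 0` for the third.
  have hab : lam (2 * t.a) ≠ 0 ∨ lam (2 * t.b) ≠ 0 := by
    by_contra! h
    rw [h.1, h.2] at hβeq
    nlinarith [hle t.c]
  have hbc : lam (2 * t.b) ≠ 0 ∨ lam (2 * t.c) ≠ 0 := by
    by_contra! h
    rw [h.1, h.2] at hβeq
    nlinarith [hle t.a]
  have hca : lam (2 * t.c) ≠ 0 ∨ lam (2 * t.a) ≠ 0 := by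
    by_contra! h
    rw [h.1, h.2] at hβeq
    nlinarith [hle t.b]
  have core : ∀ (A B C : GL (Fin 2) ℝ) (u v w : ℕ∞), T.group = reflectionGroup A B C →
      (A : Matrix (Fin 2) (Fin 2) ℝ).trace = 0 → (B : Matrix (Fin 2) (Fin 2) ℝ).trace = 0 →
      (C : Matrix (Fin 2) (Fin 2) ℝ).trace = 0 → (A : Matrix (Fin 2) (Fin 2) ℝ).det = -1 →
      (B : Matrix (Fin 2) (Fin 2) ℝ).det = -1 → (C : Matrix (Fin 2) (Fin 2) ℝ).det = -1 →
      ((B : Matrix (Fin 2) (Fin 2) ℝ) * C).trace = -lam (2 * u) →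
      ((C : Matrix (Fin 2) (Fin 2) ℝ) * A).trace = -lam (2 * v) →
      ((A : Matrix (Fin 2) (Fin 2) ℝ) * B).trace = -lam (2 * w) →
      lam (2 * u) ≠ 0 → lam (2 * v) ≠ 0 → u ∈ t.indices → v ∈ t.indices →
      t.beta = lam (2 * u) ^ 2 + lam (2 * v) ^ 2 + lam (2 * w) ^ 2
        + lam (2 * u) * lam (2 * v) * lam (2 * w) - 4 →
      invariantTraceField T.group = IntermediateField.adjoin ℚ {lam (2 * u) ^ 2,
        lam (2 * v) ^ 2, lam (2 * w) ^ 2, -(lam (2 * u) * lam (2 * v) * lam (2 * w))} ∧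
      ∃ u ∈ t.indices, ∃ w ∈ t.indices, ∃ α D : invariantTraceField T.group, α ≠ 0 ∧ D ≠ 0 ∧
        (D : ℝ) = 16 * lam (2 * u) ^ 2 * lam (2 * w) ^ 2 * t.beta ∧
        ((α : ℝ) = lam (2 * u) ^ 2 * (lam (2 * u) ^ 2 - 4) ∨ ∃ s, D = s ^ 2) ∧
        Nonempty (ℍ[invariantTraceField T.group, α, 0, D] ≃ₐ[invariantTraceField T.group]
          invariantAlgebra T.group) := by
    intro A B C u v w hG tA tB tC dA dB dC hu hv hw hu0 hv0 hut hvt hb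
    -- The traces are `-λ`, which turns the term `-xyz` into the `+λλλ` of `β`.
    have hb' : (-lam (2 * u)) ^ 2 + (-lam (2 * v)) ^ 2 + (-lam (2 * w)) ^ 2
        - -lam (2 * u) * -lam (2 * v) * -lam (2 * w) - 4 = t.beta := by
      rw [hb]
      ring
    obtain ⟨h1, α, D, hα, hD, hα', he⟩ := reflectionGroup_invariants tA tB tC dA dB dC hu hv hw
      (neg_ne_zero.2 hu0) (neg_ne_zero.2 hv0) (by rw [hb']; exact hβ.ne')
    rw [hb', neg_sq, neg_sq] at hD
    rw [neg_sq] at hα'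
    rw [hG]
    have hxyz : -lam (2 * u) * -lam (2 * v) * -lam (2 * w)
      = -(lam (2 * u) * lam (2 * v) * lam (2 * w)) := by ring
    rw [neg_sq, neg_sq, neg_sq, hxyz] at h1
    refine ⟨h1, u, hut, v, hvt, α, D, hα, ?_, hD, hα', he⟩
    rintro rfl
    have : (0 : ℝ) < 16 * lam (2 * u) ^ 2 * lam (2 * v) ^ 2 * t.beta := by positivity
    exact this.ne hD
  have r1 : reflectionGroup T.nb T.nc T.na = T.group := reflectionGroup_rotate T.na T.nb T.nc
  have r2 : reflectionGroup T.nc T.na T.nb = T.group :=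
    (reflectionGroup_rotate T.nb T.nc T.na).trans r1
  by_cases ha : lam (2 * t.a) = 0
  · obtain ⟨h1, h2⟩ := core T.nb T.nc T.na t.b t.c t.a r1.symm T.trace_nb T.trace_nc T.trace_na
      T.det_nb T.det_nc T.det_na T.trace_nc_mul_na T.trace_na_mul_nb T.trace_nb_mul_nc
      (hab.resolve_left (not_not.2 ha)) (hca.resolve_right (not_not.2 ha)) t.b_mem t.c_mem
      (by rw [hβeq]; ring)
    refine ⟨?_, h2⟩
    rw [h1, show lam (2 * t.b) * lam (2 * t.c) * lam (2 * t.a)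
      = lam (2 * t.a) * lam (2 * t.b) * lam (2 * t.c) by ring]
    congr 1
    ext
    simp only [Set.mem_insert_iff, Set.mem_singleton_iff]
    tauto
  · by_cases hb : lam (2 * t.b) = 0
    · obtain ⟨h1, h2⟩ := core T.nc T.na T.nb t.c t.a t.b r2.symm T.trace_nc T.trace_na T.trace_nb
        T.det_nc T.det_na T.det_nb T.trace_na_mul_nb T.trace_nb_mul_nc T.trace_nc_mul_na
        (hbc.resolve_left (not_not.2 hb)) ha t.c_mem t.a_mem (by rw [hβeq]; ring)
      refine ⟨?_, h2⟩
      rw [h1, show lam (2 * t.c) * lam (2 * t.a) * lam (2 * t.b)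
        = lam (2 * t.a) * lam (2 * t.b) * lam (2 * t.c) by ring]
      congr 1
      ext
      simp only [Set.mem_insert_iff, Set.mem_singleton_iff]
      tauto
    · exact core T.na T.nb T.nc t.a t.b t.c rfl T.trace_na T.trace_nb T.trace_nc
        T.det_na T.det_nb T.det_nc T.trace_nb_mul_nc T.trace_nc_mul_na T.trace_na_mul_nb
        ha hb t.a_mem t.b_mem hβeq

lemma coe_mem_K (e : invariantTraceField T.group) : ((e : ℝ) : ℂ) ∈ t.K := by
  have h : invariantTraceField T.group
      ≤ t.K.comap (Complex.ofRealAm.restrictScalars ℚ) := by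
    rw [T.group_invariants.1, IntermediateField.adjoin_le_iff]
    rintro _ (rfl | rfl | rfl | rfl)
    · change ((lam (2 * t.a) ^ 2 : ℝ) : ℂ) ∈ t.K
      push_cast
      exact (lamK t.a_mem ^ 2).2
    · change ((lam (2 * t.b) ^ 2 : ℝ) : ℂ) ∈ t.K
      push_cast
      exact (lamK t.b_mem ^ 2).2
    · change ((lam (2 * t.c) ^ 2 : ℝ) : ℂ) ∈ t.K
      push_cast
      exact (lamK t.c_mem ^ 2).2
    · change ((-(lam (2 * t.a) * lam (2 * t.b) * lam (2 * t.c)) : ℝ) : ℂ) ∈ t.K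
      push_cast
      exact (-(lamK t.a_mem * lamK t.b_mem * lamK t.c_mem)).2
  exact h e.2

/-- The inclusion of the invariant trace field in `K`. -/
noncomputable def toK : invariantTraceField T.group →ₐ[ℚ] t.K :=
  ((Complex.ofRealAm.restrictScalars ℚ).comp (invariantTraceField T.group).val).codRestrict
    t.K.toSubalgebra T.coe_mem_K

lemma toK_eq {e : invariantTraceField T.group} {x : t.K} (h : ((e : ℝ) : ℂ) = x) :
    T.toK e = x := Subtype.ext h

/-- The embedding `σ_k` of the invariant trace field. -/
noncomputable def sigmaEmbedding (k : (ZMod (2 * t.m))ˣ) : invariantTraceField T.group →ₐ[ℚ] ℂ :=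
  t.K.val.comp ((t.sigma k).toAlgHom.comp T.toK)

lemma sigmaEmbedding_apply (k : (ZMod (2 * t.m))ˣ) (e : invariantTraceField T.group) :
    T.sigmaEmbedding k e = (t.sigma k (T.toK e) : ℂ) := rfl

lemma mem_H_iff (k : (ZMod (2 * t.m))ˣ) : k ∈ T.H ↔ ∀ e, t.sigma k (T.toK e) = T.toK e := by
  change t.sigma k ∈ T.traceFieldInK.fixingSubgroup ↔ _
  rw [IntermediateField.mem_fixingSubgroup_iff]
  constructor
  · intro h e
    exact h _ ⟨e, e.2, rfl⟩
  · rintro h x ⟨e, he, hx⟩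
    rw [← T.toK_eq (e := ⟨e, he⟩) (x := x) hx]
    exact h _

/-- Two automorphisms of `K` agree on `E` exactly when `σ_k⁻¹ σ_{k'}` fixes `E`. -/
lemma sigmaEmbedding_eq_iff {k k' : (ZMod (2 * t.m))ˣ} :
    T.sigmaEmbedding k = T.sigmaEmbedding k'
      ↔ (k : (ZMod (2 * t.m))ˣ ⧸ T.H) = (k' : (ZMod (2 * t.m))ˣ ⧸ T.H) := by
  rw [QuotientGroup.eq, mem_H_iff]
  constructor
  · intro h e
    have he : t.sigma k (T.toK e) = t.sigma k' (T.toK e) := Subtype.ext (DFunLike.congr_fun h e)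
    rw [map_mul, map_inv, AlgEquiv.mul_apply, ← he]
    exact AlgEquiv.symm_apply_apply _ _
  · intro h
    ext e
    have he := congrArg (t.sigma k) (h e)
    rw [← AlgEquiv.mul_apply, ← map_mul, mul_inv_cancel_left] at he
    rw [sigmaEmbedding_apply, sigmaEmbedding_apply, he]

/-- Since `K` is algebraic over `E`, `φ` extends to an embedding of `K` in `ℂ`; since `K` is normal
over `ℚ`, the extension is an automorphism of `K`, so some `σ_k`. -/
lemma exists_sigmaEmbedding (φ : invariantTraceField T.group →+* ℂ) :
    ∃ k, φ = (T.sigmaEmbedding k).toRingHom := by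
  let : Algebra (invariantTraceField T.group) t.K := T.toK.toRingHom.toAlgebra
  let : Algebra (invariantTraceField T.group) ℂ := φ.toAlgebra
  have : FiniteDimensional ℚ t.K := IsCyclotomicExtension.finiteDimensional {2 * t.m} ℚ t.K
  have : IsGalois ℚ t.K := IsCyclotomicExtension.isGalois {2 * t.m} ℚ t.K
  have : IsScalarTower ℚ (invariantTraceField T.group) t.K :=
    IsScalarTower.of_algebraMap_eq' T.toK.comp_algebraMap.symm
  have : Algebra.IsAlgebraic (invariantTraceField T.group) t.K :=
    Algebra.IsAlgebraic.tower_top (K := ℚ) _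
  let ψ : t.K →ₐ[invariantTraceField T.group] ℂ := IsAlgClosed.lift
  let ψ' : t.K →ₐ[ℚ] ℂ := ψ.toRingHom.toRatAlgHom
  refine ⟨t.sigma.symm (ψ'.restrictNormal' t.K), ?_⟩
  ext e
  have h1 : φ e = ψ (T.toK e) := (ψ.commutes e).symm
  have h2 := ψ'.restrictNormal_commutes t.K (T.toK e)
  change _ = T.sigmaEmbedding _ e
  rw [sigmaEmbedding_apply, MulEquiv.apply_symm_apply, h1]
  exact h2.symm

lemma sigmaEmbedding_sq (k : (ZMod (2 * t.m))ˣ) {s : ℕ∞} (hs : s ∈ t.indices)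
    {e : invariantTraceField T.group} (he : (e : ℝ) = lam (2 * s) ^ 2) :
    T.sigmaEmbedding k e = (((2 * t.cosK k s) ^ 2 : ℝ) : ℂ) := by
  rw [sigmaEmbedding_apply, T.toK_eq (x := lamK hs ^ 2) (by rw [he]; push_cast; rfl), map_pow]
  push_cast
  rw [← Complex.ofReal_ofNat, ← Complex.ofReal_mul, ← sigma_lam k hs]

/-- Complex conjugation fixes the images of the four generators of `E`, which are polynomials in
real cosines. -/
lemma isReal_sigmaEmbedding (k : (ZMod (2 * t.m))ˣ) :
    ComplexEmbedding.IsReal (T.sigmaEmbedding k).toRingHom := by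
  have h : (Complex.conjAe.toAlgHom.restrictScalars ℚ).comp (T.sigmaEmbedding k)
      = T.sigmaEmbedding k := by
    have hreal : ∀ (e : invariantTraceField T.group) (r : ℝ), T.sigmaEmbedding k e = r →
        (Complex.conjAe.toAlgHom.restrictScalars ℚ).comp (T.sigmaEmbedding k) e
          = T.sigmaEmbedding k e := by
      intro e r h
      change (starRingEnd ℂ) (T.sigmaEmbedding k e) = T.sigmaEmbedding k e
      rw [h, Complex.conj_ofReal]
    refine IntermediateField.algHom_ext_of_eq_adjoin ℚ T.group_invariants.1 ?_
    rintro x (rfl | rfl | rfl | rfl)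
    · exact hreal _ _ (T.sigmaEmbedding_sq k t.a_mem rfl)
    · exact hreal _ _ (T.sigmaEmbedding_sq k t.b_mem rfl)
    · exact hreal _ _ (T.sigmaEmbedding_sq k t.c_mem rfl)
    · have : ∀ e : invariantTraceField T.group,
          (e : ℝ) = -(lam (2 * t.a) * lam (2 * t.b) * lam (2 * t.c)) →
          T.sigmaEmbedding k e
            = ((-(2 * t.cosK k t.a * (2 * t.cosK k t.b) * (2 * t.cosK k t.c)) : ℝ) : ℂ) := by
        intro e he
        rw [sigmaEmbedding_apply, T.toK_eq (x := -(lamK t.a_mem * lamK t.b_mem * lamK t.c_mem))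
          (by rw [he]; push_cast; rfl), map_neg, map_mul, map_mul, Complex.ofReal_neg,
          Complex.ofReal_mul, Complex.ofReal_mul, ← sigma_lam k t.a_mem, ← sigma_lam k t.b_mem,
          ← sigma_lam k t.c_mem]
        rfl
      exact hreal _ _ (this _ rfl)
  ext e
  exact DFunLike.congr_fun h e

/-- The place of the invariant trace field defined by the embedding `σ_k`. -/
noncomputable def place (k : (ZMod (2 * t.m))ˣ) : InfinitePlace (invariantTraceField T.group) :=
  InfinitePlace.mk (T.sigmaEmbedding k).toRingHom

/-- A place determines its embedding up to conjugation, and these embeddings are real. -/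
lemma place_eq_iff {k k' : (ZMod (2 * t.m))ˣ} : T.place k = T.place k'
    ↔ (k : (ZMod (2 * t.m))ˣ ⧸ T.H) = (k' : (ZMod (2 * t.m))ˣ ⧸ T.H) := by
  rw [← sigmaEmbedding_eq_iff, place, place, InfinitePlace.mk_eq_iff,
    ComplexEmbedding.isReal_iff.1 (T.isReal_sigmaEmbedding k), or_self]
  constructor
  · intro h
    ext e
    exact DFunLike.congr_fun h e
  · intro h
    rw [h]

lemma exists_place (v : InfinitePlace (invariantTraceField T.group)) : ∃ k, v = T.place k := by
  obtain ⟨k, hk⟩ := T.exists_sigmaEmbedding v.embedding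
  exact ⟨k, by rw [place, ← hk, InfinitePlace.mk_embedding]⟩

lemma sigmaBeta_eq_sigmaEmbedding (k : (ZMod (2 * t.m))ˣ) {e : invariantTraceField T.group}
    (he : (e : ℝ) = t.beta) : T.sigmaEmbedding k e = t.sigmaBeta k := by
  rw [sigmaEmbedding_apply, T.toK_eq (x := ⟨(t.beta : ℂ), t.beta_mem⟩) (by rw [he]), sigmaBeta]

lemma lam_sq_mem {s : ℕ∞} (hs : s ∈ t.indices) :
    lam (2 * s) ^ 2 ∈ invariantTraceField T.group := by
  rw [T.group_invariants.1]
  apply IntermediateField.subset_adjoin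
  rcases hs with rfl | rfl | rfl <;> simp

lemma beta_mem_invariantTraceField : t.beta ∈ invariantTraceField T.group := by
  have h : -(lam (2 * t.a) * lam (2 * t.b) * lam (2 * t.c)) ∈ invariantTraceField T.group := by
    rw [T.group_invariants.1]
    exact IntermediateField.subset_adjoin _ _ (by simp)
  rw [beta_eq, ← neg_neg (lam (2 * t.a) * lam (2 * t.b) * lam (2 * t.c))]
  exact sub_mem (add_mem (add_mem (add_mem (T.lam_sq_mem t.a_mem) (T.lam_sq_mem t.b_mem))
    (T.lam_sq_mem t.c_mem)) (neg_mem h)) (ofNat_mem _ 4)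

/-- The invariant quaternion algebra splits at the place `σ_k` if and only if `σ_k(β) > 0`. -/
lemma place_mem_splitRealPlaces_iff (k : (ZMod (2 * t.m))ˣ) :
    T.place k ∈ splitRealPlaces (invariantTraceField T.group) (invariantAlgebra T.group)
      ↔ 0 < t.sigmaBeta k := by
  have hv : (T.place k).IsReal := ⟨_, T.isReal_sigmaEmbedding k, rfl⟩
  obtain ⟨-, u, hu, w, hw, α, D, hα, hD0, hD, hα', ⟨e⟩⟩ := T.group_invariants
  set ψ := InfinitePlace.embedding_of_isReal hv
  have hψ : ∀ x, (ψ x : ℂ) = T.sigmaEmbedding k x := fun x => by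
    rw [InfinitePlace.embedding_of_isReal_apply, place,
      InfinitePlace.embedding_mk_eq_of_isReal (T.isReal_sigmaEmbedding k)]
    rfl
  let U : invariantTraceField T.group := ⟨_, T.lam_sq_mem hu⟩
  let W : invariantTraceField T.group := ⟨_, T.lam_sq_mem hw⟩
  let b : invariantTraceField T.group := ⟨_, T.beta_mem_invariantTraceField⟩
  have hU : ψ U = (2 * t.cosK k u) ^ 2 :=
    Complex.ofReal_injective (by rw [hψ, T.sigmaEmbedding_sq k hu rfl])
  have hW : ψ W = (2 * t.cosK k w) ^ 2 :=
    Complex.ofReal_injective (by rw [hψ, T.sigmaEmbedding_sq k hw rfl])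
  have hb : ψ b = -4 * t.kappa k :=
    Complex.ofReal_injective (by rw [hψ, T.sigmaBeta_eq_sigmaEmbedding k rfl, sigmaBeta_eq])
  have hDψ : ψ D = 16 * (2 * t.cosK k u) ^ 2 * (2 * t.cosK k w) ^ 2 * (-4 * t.kappa k) := by
    have : D = 16 * U * W * b := Subtype.ext hD
    rw [this, map_mul, map_mul, map_mul, hU, hW, hb, map_ofNat]
  have hψD0 : ψ D ≠ 0 := (map_ne_zero ψ).2 hD0
  -- Either `α = U(U - 4)` with `ψ U = 4cos² ∈ [0, 4]`, so `ψ α` is nonpositive and nonzero, or `D`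
  -- is a square and `ψ D < 0` is impossible.
  have hneg : ψ D < 0 → ψ α < 0 := by
    intro hlt
    rcases hα' with h | ⟨s, rfl⟩
    · have hαψ : ψ α = (2 * t.cosK k u) ^ 2 * ((2 * t.cosK k u) ^ 2 - 4) := by
        have : α = U * (U - 4) := Subtype.ext h
        rw [this, map_mul, map_sub, hU, map_ofNat]
      refine lt_of_le_of_ne ?_ ((map_ne_zero ψ).2 hα)
      rw [hαψ]
      refine mul_nonpos_of_nonneg_of_nonpos (sq_nonneg _) ?_
      have : t.cosK k u ^ 2 ≤ 1 := Real.cos_sq_le_one _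
      linarith
    · rw [map_pow] at hlt
      exact absurd hlt (not_lt.2 (sq_nonneg _))
  have hsplit := (isSplitAt_congr e ψ).symm.trans (isSplitAt_quaternion_iff hα hD0 ψ hneg)
  rw [sigmaBeta_pos_iff]
  constructor
  · rintro ⟨_, h⟩
    have hpos := hsplit.1 h
    rw [hDψ] at hpos
    by_contra hk
    have : -4 * t.kappa k ≤ 0 := by linarith
    exact absurd hpos (not_lt.2 (mul_nonpos_of_nonneg_of_nonpos (by positivity) this))
  · intro h
    -- The cosine factors are only visibly nonnegative; strictness comes from `ψ D ≠ 0`.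
    refine ⟨hv, hsplit.2 (lt_of_le_of_ne ?_ hψD0.symm)⟩
    rw [hDψ]
    have : 0 ≤ -4 * t.kappa k := by linarith
    positivity

/-- The place attached to a class modulo `H`, a bijection onto the places of the invariant
trace field. -/
noncomputable def placeOfClass (x : (ZMod (2 * t.m))ˣ ⧸ T.H) :
    InfinitePlace (invariantTraceField T.group) := T.place x.out

lemma placeOfClass_coe (k : (ZMod (2 * t.m))ˣ) : T.placeOfClass k = T.place k :=
  T.place_eq_iff.2 (QuotientGroup.out_eq' _)

lemma placeOfClass_injective : Function.Injective T.placeOfClass := by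
  intro x y h
  have := T.place_eq_iff.1 h
  rwa [QuotientGroup.out_eq', QuotientGroup.out_eq'] at this

/-- `placeOfClass` is injective and reaches every place of `E`, so it carries the positive classes
bijectively onto the split real places. -/
theorem adim_eq : adim T.group
    = {x : (ZMod (2 * t.m))ˣ ⧸ T.H | ∃ k : (ZMod (2 * t.m))ˣ, x = k ∧ 0 < t.sigmaBeta k}.ncard := by
  rw [← Set.ncard_image_of_injective _ T.placeOfClass_injective, adim]
  congr 1
  ext v
  constructor
  · intro hv
    obtain ⟨k, rfl⟩ := T.exists_place v
    exact ⟨k, ⟨k, rfl, (T.place_mem_splitRealPlaces_iff k).1 hv⟩, T.placeOfClass_coe k⟩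
  · rintro ⟨_, ⟨k, rfl, hk⟩, rfl⟩
    rw [placeOfClass_coe]
    exact (T.place_mem_splitRealPlaces_iff k).2 hk

/-- `β` lies in `E`, so `σ_k(β)` depends only on the restriction of `σ_k` to `E`. -/
theorem sigmaBeta_eq_of_class_eq {k k' : (ZMod (2 * t.m))ˣ}
    (h : (k : (ZMod (2 * t.m))ˣ ⧸ T.H) = (k' : (ZMod (2 * t.m))ˣ ⧸ T.H)) :
    t.sigmaBeta k = t.sigmaBeta k' := by
  rw [← T.sigmaBeta_eq_sigmaEmbedding k (e := ⟨_, T.beta_mem_invariantTraceField⟩) rfl,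
    T.sigmaEmbedding_eq_iff.2 h, T.sigmaBeta_eq_sigmaEmbedding k' rfl]

end Triangle

end TriangleGroup

theorem lemma1p2 (t : HyperbolicTriple) (T : Triangle t) :
    -- the conditions on `k` depend only on the class of `k` modulo `H`
    (∀ k k' : (ZMod (2 * t.m))ˣ,
      (k : (ZMod (2 * t.m))ˣ ⧸ T.H) = (k' : (ZMod (2 * t.m))ˣ ⧸ T.H) →
        t.sigmaBeta k = t.sigmaBeta k' ∧ t.kappa k = t.kappa k') ∧
    adim T.group
      = {x : (ZMod (2 * t.m))ˣ ⧸ T.H | ∃ k : (ZMod (2 * t.m))ˣ, x = k ∧ 0 < t.sigmaBeta k}.ncard ∧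
    adim T.group
      = {x : (ZMod (2 * t.m))ˣ ⧸ T.H | ∃ k : (ZMod (2 * t.m))ˣ, x = k ∧ t.kappa k < 0}.ncard ∧
    {x : (ZMod (2 * t.m))ˣ ⧸ T.H | ∃ k : (ZMod (2 * t.m))ˣ, x = k ∧ 0 < t.sigmaBeta k}
      = {x : (ZMod (2 * t.m))ˣ ⧸ T.H | ∃ k : (ZMod (2 * t.m))ˣ, x = k ∧ t.kappa k < 0} := by
  have hset : {x : (ZMod (2 * t.m))ˣ ⧸ T.H | ∃ k : (ZMod (2 * t.m))ˣ, x = k ∧ 0 < t.sigmaBeta k}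
      = {x : (ZMod (2 * t.m))ˣ ⧸ T.H | ∃ k : (ZMod (2 * t.m))ˣ, x = k ∧ t.kappa k < 0} := by
    simp only [t.sigmaBeta_pos_iff]
  refine ⟨fun k k' h => ?_, T.adim_eq, hset ▸ T.adim_eq, hset⟩
  have hβ := T.sigmaBeta_eq_of_class_eq h
  refine ⟨hβ, ?_⟩
  rw [t.sigmaBeta_eq, t.sigmaBeta_eq] at hβ
  have := Complex.ofReal_injective hβ
  linarith
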